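/- Let $\mathbb K$ be a field of characteristic zero. Operads are symmetric operads in $\mathbb Z$-graded $\mathbb K$-vector spaces, $\mathcal F(E)$ is the free operad on a graded $\mathbb S$-module $E$, $\mathcal F_{(2)}(E)\subset\mathcal F(E)$ is the span of the decorated trees with two vertices, and $(X)$ is the operadic ideal generated by $X$. All generators below have arity two, $V[k]$ denotes the shift with $V[k]^i=V^{i+k}$ (so $\mathbb K[-1]$ is in degree $1$), and elements of $\mathcal F_{(2)}(E)(3)$ are written as composites of binary operations applied to leaves labelled $a,b,c$, e.g. $x(y(a,b),c)=x\circ_1y$ and $x(a,y(b,c))=x\circ_2y$ up to relabelling. For an $\mathbb S$-module $E$ let $E^\vee(n)=E(n)^*\otimes\mathrm{sgn}_n$ (with $(E^\vee)_d$ dual to $E_{-d}$); let $\langle\ ,\ \rangle\colon\mathcal F_{(2)}(E^\vee)\otimes\mathcal F_{(2)}(E)\to\mathbb K$ be the natural pairing: different trees are orthogonal, $\langle f(g(a,b),c),x(y(a,b),c)\rangle=f(x)g(y)$ when $(a,b,c)$ is a cyclic rotation of $(1,2,3)$; thus $\langle\sigma u,\sigma v\rangle=\mathrm{sgn}(\sigma)\langle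 u,v\rangle$ for $\sigma\in\mathbb S_3$. The Koszul dual operad of $\mathcal P=\mathcal F(E)/(R)$, $R\subset\mathcal F_{(2)}(E)$, is $\mathcal P^!=\mathcal F(E^\vee)/(R^\perp)$. The operad $\mathcal{B}i\mathcal{N}ij=\mathcal F(M)/(R)$ has generators $M(2)=\mathbb 1_2[-1]\oplus\mathbb K[\mathbb S_2]\oplus\mathbb K[\mathbb S_2]$, $M(n)=0$ for $n\ne2$, where the natural generators are a symmetric bracket $[\,,]$ of degree $1$ and two products $\circ$, $\bullet$ of degree $0$; $R$ consists of the following relations, for all permutations $(a,b,c)$ of $(1,2,3)$: * $(a*b)*c-a*(b*c)-(a*c)*b+a*(c*b)$ for $*=\circ$ and for $*=\bullet$; * $(a\circ b)\bullet c-a\bullet(b\circ c)-(a\circ c)\bullet b+a\bullet(c\circ b)+(a\bullet b)\circ c-a\circ(b\bullet c)-(a\bullet c)\circ b+a\circ(c\bullet b)$; * $[[1,2],3]+[[2,3],1]+[[3,1],2]$; * $[a,b]*c+a*[b,c]+b*[a,c]-[a,b*c]-[b,a*c]$ for $*=\circ$ and for $*=\bullet$. **Proposition.** The Koszul dual operad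 of $\mathcal{B}i\mathcal{N}ij$ is the quadratic operad $\mathcal{B}i\mathcal{N}ij^!=\mathcal F(N)/(S)$, where $$N(2)=\mathrm{sgn}_2[1]\oplus\mathbb K[\mathbb S_2]\otimes\mathrm{sgn}_2\oplus\mathbb K[\mathbb S_2]\otimes\mathrm{sgn}_2,\qquad N(n)=0\ (n\neq2),$$ with natural generators $\nu$ (skew-symmetric, of degree $-1$), $\circ$ and $\bullet$ (of degree $0$), and $S$ consists of the following relations, for all permutations $(a,b,c)$ of $(1,2,3)$: * $(a\circ b)\circ c-a\circ(b\circ c)$, $(a\circ b)\circ c-(a\circ c)\circ b$, $(a\bullet b)\bullet c-a\bullet(b\bullet c)$, $(a\bullet b)\bullet c-(a\bullet c)\bullet b$; * $(a\circ b)\bullet c-a\bullet(b\circ c)$, $(a\circ b)\bullet c-(a\circ c)\bullet b$, $(a\bullet b)\circ c-a\circ(b\bullet c)$, $(a\bullet b)\circ c-(a\bullet c)\circ b$; * $(a\circ b)\bullet c-(a\bullet b)\circ c$, $a\bullet(b\circ c)-a\circ(b\bullet c)$; * $\nu(\nu(a,b),c)+\nu(a,\nu(b,c))$ (associativity of the odd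 operation $\nu$, the sign being the Koszul sign; equivalently $\nu(\nu(a,b),c)=\nu(\nu(b,c),a)$, as $\nu$ is skew); * $\nu(a*b,c)-\nu(a,c)*b$ and $a*\nu(b,c)-\nu(a,c)*b+\nu(a,b)*c$ for $*=\circ$ and for $*=\bullet$. More precisely, there is an isomorphism of graded $\mathbb S$-modules $\varphi\colon N\to M^\vee$ sending $\nu,\circ,\bullet$ to the functionals dual to $[\,,],\circ,\bullet$ (with respect to the basis of $M(2)$ consisting of the three generators and of $\circ(12)$, $\bullet(12)$). It carries the span of $S$ onto the orthogonal complement $R^\perp$, and it extends to an isomorphism of graded operads $\mathcal F(N)/(S)\cong\mathcal F(M^\vee)/(R^\perp)=\mathcal{B}i\mathcal{N}ij^!$. -/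

import Mathlib

open scoped TensorProduct DirectSum

universe u

namespace BiNijenhuis

/-! ## Graded operads

Composition is indexed by an input `i` of the first operation together with a bijection `e`
labelling the leaves of the grafted tree, so `comp i e a b` is the usual partial composite
`a ∘ᵢ b`, relabelled: a leaf `x ≠ i` of `a` gets the label `e (inl x)` and a leaf `y` of `b` gets
the label `e (inr y)`. The symmetric group acts by `act σ`: the leaf labelled `x` gets the
label `σ x`. -/

/-- Labellings of the tree obtained by grafting an `n`-corolla on the input `i` of an
`m`-corolla. -/
abbrev Graft {m : ℕ} (i : Fin m) (n k : ℕ) : Type := ({x : Fin m // x ≠ i} ⊕ Fin n) ≃ Fin k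

/-- The compatibility of labellings in `(a ∘ᵢ b) ∘ c = a ∘ᵢ (b ∘ⱼ c)`. -/
structure SeqCompat {m n l u v w : ℕ} {i : Fin m} {j : Fin n}
    (f : Graft j l u) (e : Graft i u w) (f' : Graft i n v) (e' : Graft (f' (Sum.inr j)) l w) :
    Prop where
  root : ∀ x : {x : Fin m // x ≠ i},
    e' (Sum.inl ⟨f' (Sum.inl x), f'.injective.ne Sum.inl_ne_inr⟩) = e (Sum.inl x)
  mid : ∀ y : {y : Fin n // y ≠ j},
    e' (Sum.inl ⟨f' (Sum.inr y.1), f'.injective.ne (Sum.inr_injective.ne y.2)⟩) =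
      e (Sum.inr (f (Sum.inl y)))
  top : ∀ z : Fin l, e' (Sum.inr z) = e (Sum.inr (f (Sum.inr z)))

/-- The compatibility of labellings in `(a ∘ᵢ b) ∘ₖ c = ± (a ∘ₖ c) ∘ᵢ b`, for `i ≠ k`. -/
structure ParCompat {m n l u u' w : ℕ} {i k : Fin m} (hik : i ≠ k)
    (f : Graft i n u) (g : Graft (f (Sum.inl ⟨k, hik.symm⟩)) l w)
    (f' : Graft k l u') (g' : Graft (f' (Sum.inl ⟨i, hik⟩)) n w) : Prop where
  root : ∀ (x : Fin m) (hi : x ≠ i) (hk : x ≠ k),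
    g (Sum.inl ⟨f (Sum.inl ⟨x, hi⟩),
        f.injective.ne (Sum.inl_injective.ne (fun h => hk (congrArg Subtype.val h)))⟩) =
      g' (Sum.inl ⟨f' (Sum.inl ⟨x, hk⟩),
        f'.injective.ne (Sum.inl_injective.ne (fun h => hi (congrArg Subtype.val h)))⟩)
  left : ∀ y : Fin n,
    g (Sum.inl ⟨f (Sum.inr y), f.injective.ne Sum.inr_ne_inl⟩) = g' (Sum.inr y)
  right : ∀ z : Fin l,
    g (Sum.inr z) = g' (Sum.inl ⟨f' (Sum.inr z), f'.injective.ne Sum.inr_ne_inl⟩)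

/-- The compatibility of labellings in `(σ a) ∘_{σ i} b = a ∘ᵢ b`. -/
structure ActCompat {m n k : ℕ} (σ : Equiv.Perm (Fin m)) {i : Fin m}
    (e : Graft (σ i) n k) (e' : Graft i n k) : Prop where
  root : ∀ x : {x : Fin m // x ≠ i},
    e (Sum.inl ⟨σ x.1, σ.injective.ne x.2⟩) = e' (Sum.inl x)
  top : ∀ y : Fin n, e (Sum.inr y) = e' (Sum.inr y)

/-- The relabelling `σ` with `a ∘ᵢ 1 = σ a`. -/
structure UnitCompat {m : ℕ} {i : Fin m} (e : Graft i 1 m) (σ : Equiv.Perm (Fin m)) :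
    Prop where
  root : ∀ x : {x : Fin m // x ≠ i}, e (Sum.inl x) = σ x.1
  top : e (Sum.inr 0) = σ i

/-- The Koszul sign `(-1) ^ (q * s)` in `K`. -/
def koszulSign (K : Type u) [Field K] (q s : ℤ) : K := (((q * s).negOnePow : ℤˣ) : ℤ)

/-- A symmetric unital operad in `ℤ`-graded `K`-vector spaces; `obj n d` is the space of
operations of arity `n` and degree `d`. -/
structure GrOperad (K : Type u) [Field K] where
  obj : ℕ → ℤ → Type u
  [acg : ∀ n d, AddCommGroup (obj n d)]
  [mod : ∀ n d, Module K (obj n d)]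
  one : obj 1 0
  act : ∀ {n : ℕ} {d : ℤ}, Equiv.Perm (Fin n) → (obj n d →ₗ[K] obj n d)
  comp : ∀ {m n k : ℕ} {p q r : ℤ} (i : Fin m) (_ : Graft i n k) (_ : p + q = r),
    obj m p →ₗ[K] obj n q →ₗ[K] obj k r
  act_one : ∀ {n : ℕ} {d : ℤ} (a : obj n d), act 1 a = a
  act_mul : ∀ {n : ℕ} {d : ℤ} (σ τ : Equiv.Perm (Fin n)) (a : obj n d),
    act (σ * τ) a = act σ (act τ a)
  act_comp : ∀ {m n k : ℕ} {p q r : ℤ} (i : Fin m) (e : Graft i n k) (h : p + q = r)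
    (τ : Equiv.Perm (Fin k)) (a : obj m p) (b : obj n q),
    act τ (comp i e h a b) = comp i (e.trans τ) h a b
  comp_act_left : ∀ {m n k : ℕ} {p q r : ℤ} (σ : Equiv.Perm (Fin m)) (i : Fin m)
    (e : Graft (σ i) n k) (e' : Graft i n k) (h : p + q = r) (a : obj m p) (b : obj n q),
    ActCompat σ e e' → comp (σ i) e h (act σ a) b = comp i e' h a b
  comp_act_right : ∀ {m n k : ℕ} {p q r : ℤ} (i : Fin m) (e : Graft i n k) (h : p + q = r)
    (τ : Equiv.Perm (Fin n)) (a : obj m p) (b : obj n q),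
    comp i e h a (act τ b) = comp i (((Equiv.refl _).sumCongr τ).trans e) h a b
  one_comp : ∀ {n : ℕ} {d : ℤ} (i : Fin 1) (e : Graft i n n) (h : 0 + d = d)
    (τ : Equiv.Perm (Fin n)) (a : obj n d), (∀ x, e (Sum.inr x) = τ x) →
    comp i e h one a = act τ a
  comp_one : ∀ {m : ℕ} {d : ℤ} (i : Fin m) (e : Graft i 1 m) (h : d + 0 = d)
    (σ : Equiv.Perm (Fin m)) (a : obj m d), UnitCompat e σ →
    comp i e h a one = act σ a
  comp_assoc : ∀ {m n l u v w : ℕ} {p q s pq qs t : ℤ} (i : Fin m) (j : Fin n)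
    (f : Graft j l u) (e : Graft i u w) (f' : Graft i n v) (e' : Graft (f' (Sum.inr j)) l w)
    (h₁ : p + q = pq) (h₂ : pq + s = t) (h₃ : q + s = qs) (h₄ : p + qs = t)
    (a : obj m p) (b : obj n q) (c : obj l s), SeqCompat f e f' e' →
    comp (f' (Sum.inr j)) e' h₂ (comp i f' h₁ a b) c = comp i e h₄ a (comp j f h₃ b c)
  comp_comm : ∀ {m n l u u' w : ℕ} {p q s pq ps t : ℤ} (i k : Fin m) (hik : i ≠ k)
    (f : Graft i n u) (g : Graft (f (Sum.inl ⟨k, hik.symm⟩)) l w)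
    (f' : Graft k l u') (g' : Graft (f' (Sum.inl ⟨i, hik⟩)) n w)
    (h₁ : p + q = pq) (h₂ : pq + s = t) (h₃ : p + s = ps) (h₄ : ps + q = t)
    (a : obj m p) (b : obj n q) (c : obj l s), ParCompat hik f g f' g' →
    comp (f (Sum.inl ⟨k, hik.symm⟩)) g h₂ (comp i f h₁ a b) c =
      koszulSign K q s • comp (f' (Sum.inl ⟨i, hik⟩)) g' h₄ (comp k f' h₃ a c) b

attribute [instance] GrOperad.acg GrOperad.mod

/-- An isomorphism of graded operads. -/
structure GrOperad.Iso {K : Type u} [Field K] (P Q : GrOperad K) where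
  toEquiv : ∀ (n : ℕ) (d : ℤ), P.obj n d ≃ₗ[K] Q.obj n d
  map_one : toEquiv 1 0 P.one = Q.one
  map_act : ∀ {n : ℕ} {d : ℤ} (σ : Equiv.Perm (Fin n)) (a : P.obj n d),
    toEquiv n d (P.act σ a) = Q.act σ (toEquiv n d a)
  map_comp : ∀ {m n k : ℕ} {p q r : ℤ} (i : Fin m) (e : Graft i n k) (h : p + q = r)
    (a : P.obj m p) (b : P.obj n q),
    toEquiv k r (P.comp i e h a b) = Q.comp i e h (toEquiv m p a) (toEquiv n q b)

/-! ## Operadic ideals and quotients -/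

/-- Membership in the operadic ideal generated by a family of sets of operations. -/
inductive InIdeal {K : Type u} [Field K] (P : GrOperad K) (X : ∀ n d, Set (P.obj n d)) :
    ∀ {n : ℕ} {d : ℤ}, P.obj n d → Prop
  | of {n d} (a : P.obj n d) : a ∈ X n d → InIdeal P X a
  | zero {n d} : InIdeal P X (0 : P.obj n d)
  | add {n d} (a b : P.obj n d) : InIdeal P X a → InIdeal P X b → InIdeal P X (a + b)
  | smul {n d} (c : K) (a : P.obj n d) : InIdeal P X a → InIdeal P X (c • a)
  | act {n d} (σ : Equiv.Perm (Fin n)) (a : P.obj n d) : InIdeal P X a →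
      InIdeal P X (P.act σ a)
  | comp_left {m n k p q r} (i : Fin m) (e : Graft i n k) (h : p + q = r) (a : P.obj m p)
      (b : P.obj n q) : InIdeal P X a → InIdeal P X (P.comp i e h a b)
  | comp_right {m n k p q r} (i : Fin m) (e : Graft i n k) (h : p + q = r) (a : P.obj m p)
      (b : P.obj n q) : InIdeal P X b → InIdeal P X (P.comp i e h a b)

/-- The operadic ideal generated by `X`, in arity `n` and degree `d`. -/
def genIdeal {K : Type u} [Field K] (P : GrOperad K) (X : ∀ n d, Set (P.obj n d))
    (n : ℕ) (d : ℤ) : Submodule K (P.obj n d) where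
  carrier := {a | InIdeal P X a}
  add_mem' := fun ha hb => InIdeal.add _ _ ha hb
  zero_mem' := InIdeal.zero
  smul_mem' := fun c _ ha => InIdeal.smul c _ ha

/-- The quotient of an operad by the operadic ideal generated by `X`. -/
def GrOperad.quot {K : Type u} [Field K] (P : GrOperad K) (X : ∀ n d, Set (P.obj n d)) :
    GrOperad K where
  obj := fun n d => P.obj n d ⧸ genIdeal P X n d
  one := Submodule.Quotient.mk P.one
  act := fun {n d} σ => (genIdeal P X n d).mapQ (genIdeal P X n d) (P.act σ)
    (fun a ha => InIdeal.act σ a ha)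
  comp := fun {m n k p q r} i e h =>
    (genIdeal P X m p).liftQ
      (LinearMap.flip ((genIdeal P X n q).liftQ
        (LinearMap.flip ((P.comp i e h).compr₂ (genIdeal P X k r).mkQ))
        (fun b hb => LinearMap.ext fun a =>
          (Submodule.Quotient.mk_eq_zero _).2 (InIdeal.comp_right i e h a b hb))))
      (fun a ha => LinearMap.ext fun b => by
        obtain ⟨b, rfl⟩ := Submodule.Quotient.mk_surjective _ b
        exact (Submodule.Quotient.mk_eq_zero _).2 (InIdeal.comp_left i e h a b ha))
  act_one := by
    intro n d a
    obtain ⟨a, rfl⟩ := Submodule.Quotient.mk_surjective _ a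
    exact congrArg Submodule.Quotient.mk (P.act_one a)
  act_mul := by
    intro n d σ τ a
    obtain ⟨a, rfl⟩ := Submodule.Quotient.mk_surjective _ a
    exact congrArg Submodule.Quotient.mk (P.act_mul σ τ a)
  act_comp := by
    intro m n k p q r i e h τ a b
    obtain ⟨a, rfl⟩ := Submodule.Quotient.mk_surjective _ a
    obtain ⟨b, rfl⟩ := Submodule.Quotient.mk_surjective _ b
    exact congrArg Submodule.Quotient.mk (P.act_comp i e h τ a b)
  comp_act_left := by
    intro m n k p q r σ i e e' h a b H
    obtain ⟨a, rfl⟩ := Submodule.Quotient.mk_surjective _ a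
    obtain ⟨b, rfl⟩ := Submodule.Quotient.mk_surjective _ b
    exact congrArg Submodule.Quotient.mk (P.comp_act_left σ i e e' h a b H)
  comp_act_right := by
    intro m n k p q r i e h τ a b
    obtain ⟨a, rfl⟩ := Submodule.Quotient.mk_surjective _ a
    obtain ⟨b, rfl⟩ := Submodule.Quotient.mk_surjective _ b
    exact congrArg Submodule.Quotient.mk (P.comp_act_right i e h τ a b)
  one_comp := by
    intro n d i e h τ a H
    obtain ⟨a, rfl⟩ := Submodule.Quotient.mk_surjective _ a
    exact congrArg Submodule.Quotient.mk (P.one_comp i e h τ a H)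
  comp_one := by
    intro m d i e h σ a H
    obtain ⟨a, rfl⟩ := Submodule.Quotient.mk_surjective _ a
    exact congrArg Submodule.Quotient.mk (P.comp_one i e h σ a H)
  comp_assoc := by
    intro m n l u v w p q s pq qs t i j f e f' e' h₁ h₂ h₃ h₄ a b c H
    obtain ⟨a, rfl⟩ := Submodule.Quotient.mk_surjective _ a
    obtain ⟨b, rfl⟩ := Submodule.Quotient.mk_surjective _ b
    obtain ⟨c, rfl⟩ := Submodule.Quotient.mk_surjective _ c
    exact congrArg Submodule.Quotient.mk
      (P.comp_assoc i j f e f' e' h₁ h₂ h₃ h₄ a b c H)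
  comp_comm := by
    intro m n l u u' w p q s pq ps t i k hik f g f' g' h₁ h₂ h₃ h₄ a b c H
    obtain ⟨a, rfl⟩ := Submodule.Quotient.mk_surjective _ a
    obtain ⟨b, rfl⟩ := Submodule.Quotient.mk_surjective _ b
    obtain ⟨c, rfl⟩ := Submodule.Quotient.mk_surjective _ c
    exact congrArg Submodule.Quotient.mk
      (P.comp_comm i k hik f g f' g' h₁ h₂ h₃ h₄ a b c H)

/-! ## Graded `𝕊`-modules concentrated in arity two -/

/-- A graded `𝕊`-module `E` with `E(n) = 0` for `n ≠ 2`, given by the graded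
`𝕊₂`-representation `E(2)`; `obj d` is its part of degree `d`. -/
structure BinModule (K : Type u) [Field K] where
  obj : ℤ → Type u
  [acg : ∀ d, AddCommGroup (obj d)]
  [mod : ∀ d, Module K (obj d)]
  rep : ∀ d, Representation K (Equiv.Perm (Fin 2)) (obj d)

attribute [instance] BinModule.acg BinModule.mod

/-- The tensor product of a representation of `𝕊ₙ` with the sign representation. -/
def sgnTwist {K : Type u} [Field K] {n : ℕ} {V : Type u} [AddCommGroup V] [Module K V]
    (ρ : Representation K (Equiv.Perm (Fin n)) V) :
    Representation K (Equiv.Perm (Fin n)) V where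
  toFun := fun σ => (((Equiv.Perm.sign σ : ℤˣ) : ℤ) : K) • ρ σ
  map_one' := by simp
  map_mul' := by
    intro σ τ
    ext v
    simp only [Units.val_mul, Int.cast_mul, map_mul, LinearMap.smul_apply,
      Module.End.mul_apply, map_smul, mul_smul]
    exact smul_comm _ _ _

/-- A representation of `𝕊₂` placed in the single degree `d₀`: the space of functions
`(d = d₀) → V` is a copy of `V` if `d = d₀`, and zero otherwise. -/
def BinModule.inDegree {K : Type u} [Field K] {V : Type u} [AddCommGroup V] [Module K V]
    (ρ : Representation K (Equiv.Perm (Fin 2)) V) (d₀ : ℤ) : BinModule K where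
  obj := fun d => PLift (d = d₀) → V
  rep := fun _ =>
    { toFun := fun σ => LinearMap.pi fun h => (ρ σ).comp (LinearMap.proj h)
      map_one' := by ext; simp
      map_mul' := by intro σ τ; ext; simp }

/-- The direct sum of two graded `𝕊₂`-modules. -/
def BinModule.prod {K : Type u} [Field K] (E F : BinModule K) : BinModule K where
  obj := fun d => E.obj d × F.obj d
  rep := fun d =>
    { toFun := fun σ => (E.rep d σ).prodMap (F.rep d σ)
      map_one' := by ext <;> simp
      map_mul' := by intro σ τ; ext <;> simp }

/-- The Czech dual `E^∨ = E^* ⊗ sgn`, with `(E^∨)_d = (E_{-d})^* ⊗ sgn`. -/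
def BinModule.czechDual {K : Type u} [Field K] (E : BinModule K) : BinModule K where
  obj := fun d => Module.Dual K (E.obj (-d))
  rep := fun d => sgnTwist (E.rep (-d)).dual

/-- An isomorphism of graded `𝕊₂`-modules. -/
structure BinModule.Iso {K : Type u} [Field K] (E F : BinModule K) where
  toEquiv : ∀ d : ℤ, E.obj d ≃ₗ[K] F.obj d
  map_rep : ∀ (d : ℤ) (σ : Equiv.Perm (Fin 2)) (x : E.obj d),
    toEquiv d (E.rep d σ x) = F.rep d σ (toEquiv d x)

/-! ## The free operad

The free operad is the space of formal expressions in the generators and the operad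
operations, modulo the smallest congruence containing linearity, equivariance and the operad
axioms. -/

/-- Formal operadic expressions in the generators `E`, by arity and degree. -/
inductive Pre {K : Type u} [Field K] (E : BinModule K) : ℕ → ℤ → Type u
  | gen {d : ℤ} (x : E.obj d) : Pre E 2 d
  | one : Pre E 1 0
  | zero {n : ℕ} {d : ℤ} : Pre E n d
  | add {n : ℕ} {d : ℤ} (a b : Pre E n d) : Pre E n d
  | smul {n : ℕ} {d : ℤ} (c : K) (a : Pre E n d) : Pre E n d
  | act {n : ℕ} {d : ℤ} (σ : Equiv.Perm (Fin n)) (a : Pre E n d) : Pre E n d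
  | comp {m n k : ℕ} {p q r : ℤ} (i : Fin m) (e : Graft i n k) (h : p + q = r)
      (a : Pre E m p) (b : Pre E n q) : Pre E k r

/-- The congruence on formal expressions defining the free operad. -/
inductive Rel {K : Type u} [Field K] (E : BinModule K) :
    ∀ {n : ℕ} {d : ℤ}, Pre E n d → Pre E n d → Prop
  -- equivalence relation
  | refl {n d} (a : Pre E n d) : Rel E a a
  | symm {n d} {a b : Pre E n d} : Rel E a b → Rel E b a
  | trans {n d} {a b c : Pre E n d} : Rel E a b → Rel E b c → Rel E a c
  -- congruence
  | add_congr {n d} {a a' b b' : Pre E n d} : Rel E a a' → Rel E b b' →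
      Rel E (a.add b) (a'.add b')
  | smul_congr {n d} (c : K) {a a' : Pre E n d} : Rel E a a' → Rel E (a.smul c) (a'.smul c)
  | act_congr {n d} (σ : Equiv.Perm (Fin n)) {a a' : Pre E n d} : Rel E a a' →
      Rel E (a.act σ) (a'.act σ)
  | comp_congr {m n k p q r} (i : Fin m) (e : Graft i n k) (h : p + q = r)
      {a a' : Pre E m p} {b b' : Pre E n q} : Rel E a a' → Rel E b b' →
      Rel E (Pre.comp i e h a b) (Pre.comp i e h a' b')
  -- vector space axioms
  | add_comm {n d} (a b : Pre E n d) : Rel E (a.add b) (b.add a)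
  | add_assoc {n d} (a b c : Pre E n d) : Rel E ((a.add b).add c) (a.add (b.add c))
  | zero_add {n d} (a : Pre E n d) : Rel E (Pre.zero.add a) a
  | one_smul {n d} (a : Pre E n d) : Rel E (a.smul 1) a
  | zero_smul {n d} (a : Pre E n d) : Rel E (a.smul 0) Pre.zero
  | mul_smul {n d} (c c' : K) (a : Pre E n d) : Rel E (a.smul (c * c')) ((a.smul c').smul c)
  | add_smul {n d} (c c' : K) (a : Pre E n d) :
      Rel E (a.smul (c + c')) ((a.smul c).add (a.smul c'))
  | smul_add {n d} (c : K) (a b : Pre E n d) :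
      Rel E ((a.add b).smul c) ((a.smul c).add (b.smul c))
  -- the generators form a representation
  | gen_add {d} (x y : E.obj d) : Rel E (Pre.gen (x + y)) ((Pre.gen x).add (Pre.gen y))
  | gen_smul {d} (c : K) (x : E.obj d) : Rel E (Pre.gen (c • x)) ((Pre.gen x).smul c)
  | gen_act {d} (σ : Equiv.Perm (Fin 2)) (x : E.obj d) :
      Rel E (Pre.gen (E.rep d σ x)) ((Pre.gen x).act σ)
  -- linearity of the operations
  | act_add {n d} (σ : Equiv.Perm (Fin n)) (a b : Pre E n d) :
      Rel E ((a.add b).act σ) ((a.act σ).add (b.act σ))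
  | act_smul {n d} (σ : Equiv.Perm (Fin n)) (c : K) (a : Pre E n d) :
      Rel E ((a.smul c).act σ) ((a.act σ).smul c)
  | add_comp {m n k p q r} (i : Fin m) (e : Graft i n k) (h : p + q = r)
      (a a' : Pre E m p) (b : Pre E n q) :
      Rel E (Pre.comp i e h (a.add a') b) ((Pre.comp i e h a b).add (Pre.comp i e h a' b))
  | smul_comp {m n k p q r} (i : Fin m) (e : Graft i n k) (h : p + q = r) (c : K)
      (a : Pre E m p) (b : Pre E n q) :
      Rel E (Pre.comp i e h (a.smul c) b) ((Pre.comp i e h a b).smul c)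
  | comp_add {m n k p q r} (i : Fin m) (e : Graft i n k) (h : p + q = r)
      (a : Pre E m p) (b b' : Pre E n q) :
      Rel E (Pre.comp i e h a (b.add b')) ((Pre.comp i e h a b).add (Pre.comp i e h a b'))
  | comp_smul {m n k p q r} (i : Fin m) (e : Graft i n k) (h : p + q = r) (c : K)
      (a : Pre E m p) (b : Pre E n q) :
      Rel E (Pre.comp i e h a (b.smul c)) ((Pre.comp i e h a b).smul c)
  -- operad axioms
  | act_one {n d} (a : Pre E n d) : Rel E (a.act 1) a
  | act_mul {n d} (σ τ : Equiv.Perm (Fin n)) (a : Pre E n d) :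
      Rel E (a.act (σ * τ)) ((a.act τ).act σ)
  | act_comp {m n k p q r} (i : Fin m) (e : Graft i n k) (h : p + q = r)
      (τ : Equiv.Perm (Fin k)) (a : Pre E m p) (b : Pre E n q) :
      Rel E ((Pre.comp i e h a b).act τ) (Pre.comp i (e.trans τ) h a b)
  | comp_act_left {m n k p q r} (σ : Equiv.Perm (Fin m)) (i : Fin m) (e : Graft (σ i) n k)
      (e' : Graft i n k) (h : p + q = r) (a : Pre E m p) (b : Pre E n q) :
      ActCompat σ e e' → Rel E (Pre.comp (σ i) e h (a.act σ) b) (Pre.comp i e' h a b)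
  | comp_act_right {m n k p q r} (i : Fin m) (e : Graft i n k) (h : p + q = r)
      (τ : Equiv.Perm (Fin n)) (a : Pre E m p) (b : Pre E n q) :
      Rel E (Pre.comp i e h a (b.act τ))
        (Pre.comp i (((Equiv.refl _).sumCongr τ).trans e) h a b)
  | one_comp {n d} (i : Fin 1) (e : Graft i n n) (h : 0 + d = d) (τ : Equiv.Perm (Fin n))
      (a : Pre E n d) : (∀ x, e (Sum.inr x) = τ x) → Rel E (Pre.comp i e h Pre.one a) (a.act τ)
  | comp_one {m d} (i : Fin m) (e : Graft i 1 m) (h : d + 0 = d) (σ : Equiv.Perm (Fin m))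
      (a : Pre E m d) : UnitCompat e σ → Rel E (Pre.comp i e h a Pre.one) (a.act σ)
  | comp_assoc {m n l u v w : ℕ} {p q s pq qs t : ℤ} (i : Fin m) (j : Fin n)
      (f : Graft j l u) (e : Graft i u w) (f' : Graft i n v) (e' : Graft (f' (Sum.inr j)) l w)
      (h₁ : p + q = pq) (h₂ : pq + s = t) (h₃ : q + s = qs) (h₄ : p + qs = t)
      (a : Pre E m p) (b : Pre E n q) (c : Pre E l s) : SeqCompat f e f' e' →
      Rel E (Pre.comp (f' (Sum.inr j)) e' h₂ (Pre.comp i f' h₁ a b) c)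
        (Pre.comp i e h₄ a (Pre.comp j f h₃ b c))
  | comp_comm {m n l u u' w : ℕ} {p q s pq ps t : ℤ} (i k : Fin m) (hik : i ≠ k)
      (f : Graft i n u) (g : Graft (f (Sum.inl ⟨k, hik.symm⟩)) l w)
      (f' : Graft k l u') (g' : Graft (f' (Sum.inl ⟨i, hik⟩)) n w)
      (h₁ : p + q = pq) (h₂ : pq + s = t) (h₃ : p + s = ps) (h₄ : ps + q = t)
      (a : Pre E m p) (b : Pre E n q) (c : Pre E l s) : ParCompat hik f g f' g' →
      Rel E (Pre.comp (f (Sum.inl ⟨k, hik.symm⟩)) g h₂ (Pre.comp i f h₁ a b) c)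
        ((Pre.comp (f' (Sum.inl ⟨i, hik⟩)) g' h₄ (Pre.comp k f' h₃ a c) b).smul
          (koszulSign K q s))

/-- The congruence as a setoid. -/
def relSetoid {K : Type u} [Field K] (E : BinModule K) (n : ℕ) (d : ℤ) :
    Setoid (Pre E n d) where
  r := Rel E
  iseqv := ⟨Rel.refl, Rel.symm, Rel.trans⟩

/-- The free operad in arity `n` and degree `d`. -/
def FreeObj {K : Type u} [Field K] (E : BinModule K) (n : ℕ) (d : ℤ) : Type u :=
  Quotient (relSetoid E n d)

/-- The class of a formal expression in the free operad. -/
def FreeObj.mk {K : Type u} [Field K] {E : BinModule K} {n : ℕ} {d : ℤ} (a : Pre E n d) :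
    FreeObj E n d := Quotient.mk (relSetoid E n d) a

theorem FreeObj.sound {K : Type u} [Field K] {E : BinModule K} {n : ℕ} {d : ℤ}
    {a b : Pre E n d} (h : Rel E a b) : FreeObj.mk a = FreeObj.mk b :=
  Quotient.sound (s := relSetoid E n d) h

instance FreeObj.instZero {K : Type u} [Field K] (E : BinModule K) (n : ℕ) (d : ℤ) :
    Zero (FreeObj E n d) where
  zero := FreeObj.mk Pre.zero

instance FreeObj.instAdd {K : Type u} [Field K] (E : BinModule K) (n : ℕ) (d : ℤ) :
    Add (FreeObj E n d) where
  add := Quotient.map₂ Pre.add (fun _ _ h _ _ h' => Rel.add_congr h h')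

instance FreeObj.instNeg {K : Type u} [Field K] (E : BinModule K) (n : ℕ) (d : ℤ) :
    Neg (FreeObj E n d) where
  neg := Quotient.map (Pre.smul (-1)) (fun _ _ h => Rel.smul_congr (-1) h)

instance FreeObj.instAddCommGroup {K : Type u} [Field K] (E : BinModule K) (n : ℕ) (d : ℤ) :
    AddCommGroup (FreeObj E n d) where
  add_assoc := by
    rintro ⟨a⟩ ⟨b⟩ ⟨c⟩
    exact FreeObj.sound (Rel.add_assoc a b c)
  zero_add := by
    rintro ⟨a⟩
    exact FreeObj.sound (Rel.zero_add a)
  add_zero := by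
    rintro ⟨a⟩
    exact FreeObj.sound ((Rel.add_comm a Pre.zero).trans (Rel.zero_add a))
  add_comm := by
    rintro ⟨a⟩ ⟨b⟩
    exact FreeObj.sound (Rel.add_comm a b)
  neg_add_cancel := by
    rintro ⟨a⟩
    refine FreeObj.sound (((Rel.add_congr (Rel.refl _) (Rel.one_smul a).symm).trans
      (Rel.add_smul (-1) 1 a).symm).trans ?_)
    rw [neg_add_cancel]
    exact Rel.zero_smul a
  nsmul := nsmulRec
  zsmul := zsmulRec

instance FreeObj.instModule {K : Type u} [Field K] (E : BinModule K) (n : ℕ) (d : ℤ) :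
    Module K (FreeObj E n d) where
  smul := fun c => Quotient.map (Pre.smul c) (fun _ _ h => Rel.smul_congr c h)
  one_smul := by
    rintro ⟨a⟩
    exact FreeObj.sound (Rel.one_smul a)
  mul_smul := by
    rintro c c' ⟨a⟩
    exact FreeObj.sound (Rel.mul_smul c c' a)
  smul_zero := by
    intro c
    refine FreeObj.sound (((Rel.smul_congr c (Rel.zero_smul Pre.zero).symm).trans
      (Rel.mul_smul c 0 Pre.zero).symm).trans ?_)
    rw [mul_zero]
    exact Rel.zero_smul Pre.zero
  smul_add := by
    rintro c ⟨a⟩ ⟨b⟩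
    exact FreeObj.sound (Rel.smul_add c a b)
  add_smul := by
    rintro c c' ⟨a⟩
    exact FreeObj.sound (Rel.add_smul c c' a)
  zero_smul := by
    rintro ⟨a⟩
    exact FreeObj.sound (Rel.zero_smul a)

/-- The free operad `𝓕(E)`. -/
def freeOperad {K : Type u} [Field K] (E : BinModule K) : GrOperad K where
  obj := FreeObj E
  one := FreeObj.mk Pre.one
  act := fun σ =>
    { toFun := Quotient.map (Pre.act σ) (fun _ _ h => Rel.act_congr σ h)
      map_add' := by
        rintro ⟨a⟩ ⟨b⟩
        exact FreeObj.sound (Rel.act_add σ a b)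
      map_smul' := by
        rintro c ⟨a⟩
        exact FreeObj.sound (Rel.act_smul σ c a) }
  comp := fun i e h => LinearMap.mk₂ K
    (Quotient.map₂ (Pre.comp i e h) (fun _ _ h₁ _ _ h₂ => Rel.comp_congr i e h h₁ h₂))
    (by rintro ⟨a⟩ ⟨a'⟩ ⟨b⟩; exact FreeObj.sound (Rel.add_comp i e h a a' b))
    (by rintro c ⟨a⟩ ⟨b⟩; exact FreeObj.sound (Rel.smul_comp i e h c a b))
    (by rintro ⟨a⟩ ⟨b⟩ ⟨b'⟩; exact FreeObj.sound (Rel.comp_add i e h a b b'))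
    (by rintro c ⟨a⟩ ⟨b⟩; exact FreeObj.sound (Rel.comp_smul i e h c a b))
  act_one := by
    rintro n d ⟨a⟩
    exact FreeObj.sound (Rel.act_one a)
  act_mul := by
    rintro n d σ τ ⟨a⟩
    exact FreeObj.sound (Rel.act_mul σ τ a)
  act_comp := by
    rintro m n k p q r i e h τ ⟨a⟩ ⟨b⟩
    exact FreeObj.sound (Rel.act_comp i e h τ a b)
  comp_act_left := by
    rintro m n k p q r σ i e e' h ⟨a⟩ ⟨b⟩ H
    exact FreeObj.sound (Rel.comp_act_left σ i e e' h a b H)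
  comp_act_right := by
    rintro m n k p q r i e h τ ⟨a⟩ ⟨b⟩
    exact FreeObj.sound (Rel.comp_act_right i e h τ a b)
  one_comp := by
    rintro n d i e h τ ⟨a⟩ H
    exact FreeObj.sound (Rel.one_comp i e h τ a H)
  comp_one := by
    rintro m d i e h σ ⟨a⟩ H
    exact FreeObj.sound (Rel.comp_one i e h σ a H)
  comp_assoc := by
    rintro m n l u v w p q s pq qs t i j f e f' e' h₁ h₂ h₃ h₄ ⟨a⟩ ⟨b⟩ ⟨c⟩ H
    exact FreeObj.sound (Rel.comp_assoc i j f e f' e' h₁ h₂ h₃ h₄ a b c H)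
  comp_comm := by
    rintro m n l u u' w p q s pq ps t i k hik f g f' g' h₁ h₂ h₃ h₄ ⟨a⟩ ⟨b⟩ ⟨c⟩ H
    exact FreeObj.sound (Rel.comp_comm i k hik f g f' g' h₁ h₂ h₃ h₄ a b c H)

/-- The inclusion of the generators in the free operad. -/
def freeGen {K : Type u} [Field K] (E : BinModule K) (d : ℤ) :
    E.obj d →ₗ[K] (freeOperad E).obj 2 d where
  toFun := fun x => FreeObj.mk (Pre.gen x)
  map_add' := fun x y => FreeObj.sound (Rel.gen_add x y)
  map_smul' := fun c x => FreeObj.sound (Rel.gen_smul c x)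

/-! ## The quadratic part of the free operad

A tree with two binary vertices is determined by the label `t` of the leaf attached to the
root vertex. Such a tree is drawn as `x(y(t + 1, t + 2), t)` with the labels taken modulo `3`,
where `x` decorates the root vertex and `y` the other vertex. Thus the weight two part of
`𝓕(E)`, which lives in arity `3`, is the direct sum of three copies of `E(2) ⊗ E(2)`. The
leaf labels `1, 2, 3` are the elements `0, 1, 2` of `Fin 3`. -/

/-- The weight two part `𝓕₍₂₎(E)` of the free operad: the component with index `(t, p, q)`
consists of the trees with label `t` at the root, a root vertex decorated in degree `p` and an
upper vertex decorated in degree `q`. -/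
abbrev Quad {K : Type u} [Field K] (E : BinModule K) : Type u :=
  ⨁ s : Fin 3 × ℤ × ℤ, (E.obj s.2.1 ⊗[K] E.obj s.2.2)

/-- The labels of the leaves of the tree `x(y(t + 1, t + 2), t)`. -/
def treeLabel (t : Fin 3) : ({x : Fin 2 // x ≠ 0} ⊕ Fin 2) → Fin 3
  | Sum.inl _ => t
  | Sum.inr y => if y = 0 then t + 1 else t + 2

/-- The labelling of the tree `x(y(t + 1, t + 2), t)`. -/
noncomputable def treeGraft (t : Fin 3) : Graft (0 : Fin 2) 2 3 :=
  Equiv.ofBijective (treeLabel t) (by revert t; decide)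

/-- The embedding of the weight two part in the free operad, the target being the direct sum
of all degrees in arity three. -/
noncomputable def quadEval {K : Type u} [Field K] (E : BinModule K) :
    Quad E →ₗ[K] ⨁ d : ℤ, (freeOperad E).obj 3 d :=
  DirectSum.toModule K (Fin 3 × ℤ × ℤ) (⨁ d : ℤ, (freeOperad E).obj 3 d) fun s =>
    (DirectSum.lof K ℤ (fun d => (freeOperad E).obj 3 d) (s.2.1 + s.2.2)).comp
      (TensorProduct.lift
        (((freeOperad E).comp (0 : Fin 2) (treeGraft s.1) rfl).compl₁₂
          (freeGen E s.2.1) (freeGen E s.2.2)))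

/-- The tree monomial `x(y(a, b), c)` with root vertex `x`, where `(a, b, c)` is
`(σ 0, σ 1, σ 2)`. It is already in the chosen form if `(a, b, c)` is a cyclic rotation of
`(0, 1, 2)`; otherwise the two inputs of `y` have to be exchanged. -/
noncomputable def leftTree {K : Type u} [Field K] (E : BinModule K) {p q : ℤ}
    (x : E.obj p) (y : E.obj q) (σ : Equiv.Perm (Fin 3)) : Quad E :=
  DirectSum.lof K (Fin 3 × ℤ × ℤ) (fun s => E.obj s.2.1 ⊗[K] E.obj s.2.2) (σ 2, p, q)
    (x ⊗ₜ[K] (if Equiv.Perm.sign σ = 1 then y else E.rep q (Equiv.swap 0 1) y))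

/-- The tree monomial `x(a, y(b, c))` with root vertex `x`, where `(a, b, c)` is
`(σ 0, σ 1, σ 2)`. It equals `x'(y(b, c), a)` for `x' = (12) x`. -/
noncomputable def rightTree {K : Type u} [Field K] (E : BinModule K) {p q : ℤ}
    (x : E.obj p) (y : E.obj q) (σ : Equiv.Perm (Fin 3)) : Quad E :=
  leftTree E (E.rep p (Equiv.swap 0 1) x) y (σ * finRotate 3)

/-- The map on weight two parts induced by an isomorphism of generators. -/
noncomputable def quadMap {K : Type u} [Field K] {E F : BinModule K} (φ : E.Iso F) :
    Quad E →ₗ[K] Quad F :=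
  DirectSum.lmap fun s : Fin 3 × ℤ × ℤ =>
    TensorProduct.map (φ.toEquiv s.2.1).toLinearMap (φ.toEquiv s.2.2).toLinearMap

/-- The natural pairing of the weight two parts of `𝓕(E^∨)` and `𝓕(E)`: different trees are
orthogonal, and on a tree in the chosen form decorations are paired vertex by vertex. As the
action on `E^∨` is twisted by the sign and the chosen forms of the three trees are cyclic
rotations of each other, `⟨σ f, σ x⟩ = sgn(σ) ⟨f, x⟩` for all `σ` in `𝕊₃`. -/
noncomputable def quadPairing {K : Type u} [Field K] (E : BinModule K) :
    Quad E.czechDual →ₗ[K] Quad E →ₗ[K] K :=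
  DirectSum.toModule K (Fin 3 × ℤ × ℤ) (Quad E →ₗ[K] K) fun s =>
    (LinearMap.lcomp K K (DirectSum.component K (Fin 3 × ℤ × ℤ)
        (fun s => E.obj s.2.1 ⊗[K] E.obj s.2.2) (s.1, -s.2.1, -s.2.2))).comp
      (TensorProduct.dualDistrib K (E.obj (-s.2.1)) (E.obj (-s.2.2)))

/-! ## Quadratic operads and Koszul duals -/

/-- A presentation of a binary quadratic operad by generators and relations. -/
structure QuadraticData (K : Type u) [Field K] where
  gens : BinModule K
  rels : Submodule K (Quad gens)

/-- The homogeneous components of the relations, as elements of the free operad. -/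
noncomputable def QuadraticData.relators {K : Type u} [Field K] (D : QuadraticData K) :
    ∀ (n : ℕ) (d : ℤ), Set ((freeOperad D.gens).obj n d)
  | 3, d => {a | ∃ r ∈ D.rels, quadEval D.gens r d = a}
  | _, _ => ∅

/-- The quadratic operad `𝓕(E)/(R)`. -/
noncomputable def QuadraticData.operad {K : Type u} [Field K] (D : QuadraticData K) :
    GrOperad K :=
  (freeOperad D.gens).quot D.relators

/-- The image of a generator in the quadratic operad `𝓕(E)/(R)`. -/
noncomputable def QuadraticData.gen {K : Type u} [Field K] (D : QuadraticData K) {d : ℤ}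
    (x : D.gens.obj d) : D.operad.obj 2 d :=
  (genIdeal (freeOperad D.gens) D.relators 2 d).mkQ (freeGen D.gens d x)

/-- The orthogonal complement `R^⊥` of the relations in the weight two part of `𝓕(E^∨)`. -/
noncomputable def QuadraticData.orth {K : Type u} [Field K] (D : QuadraticData K) :
    Submodule K (Quad D.gens.czechDual) where
  carrier := {f | ∀ r ∈ D.rels, quadPairing D.gens f r = 0}
  add_mem' := by
    intro f g hf hg r hr
    rw [map_add, LinearMap.add_apply, hf r hr, hg r hr, add_zero]
  zero_mem' := by
    intro r _
    rw [map_zero, LinearMap.zero_apply]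
  smul_mem' := by
    intro c f hf r hr
    rw [map_smul, LinearMap.smul_apply, hf r hr, smul_zero]

/-- The presentation `(E^∨, R^⊥)` of the Koszul dual operad of `𝓕(E)/(R)`. -/
noncomputable def QuadraticData.koszulDual {K : Type u} [Field K] (D : QuadraticData K) :
    QuadraticData K where
  gens := D.gens.czechDual
  rels := D.orth

/-! ## The operad of bi-Nijenhuis structures -/

/-- The regular representation `K[𝕊₂]`; its elements are functions on `𝕊₂`, and
`(σ f)(τ) = f(σ⁻¹ τ)`. -/
def regular (K : Type u) [Field K] :
    Representation K (Equiv.Perm (Fin 2)) (Equiv.Perm (Fin 2) → K) where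
  toFun := fun σ => LinearMap.funLeft K K (fun τ => σ⁻¹ * τ)
  map_one' := by
    ext f τ
    simp [LinearMap.funLeft_apply]
  map_mul' := by
    intro σ τ
    ext f x
    simp [LinearMap.funLeft_apply, mul_assoc]

/-- The unit element of `K[𝕊₂]`. -/
def regOne (K : Type u) [Field K] : Equiv.Perm (Fin 2) → K := Pi.single 1 1

/-- The generators of the bi-Nijenhuis operad: the trivial representation in degree `1`
(that is, `𝟙₂[-1]`) and two copies of `K[𝕊₂]` in degree `0`. -/
def genM (K : Type u) [Field K] : BinModule K :=
  (BinModule.inDegree (Representation.trivial K (Equiv.Perm (Fin 2)) K) 1).prod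
    ((BinModule.inDegree (regular K) 0).prod (BinModule.inDegree (regular K) 0))

/-- The generator of `𝟙₂[-1]`, the odd Lie bracket. -/
def mY (K : Type u) [Field K] : (genM K).obj 1 := (fun _ => 1, 0, 0)

/-- The first (white) pre-Lie product. -/
def mW (K : Type u) [Field K] : (genM K).obj 0 := (0, fun _ => regOne K, 0)

/-- The second (black) pre-Lie product. -/
def mB (K : Type u) [Field K] : (genM K).obj 0 := (0, 0, fun _ => regOne K)

/-- The pre-Lie relation `(a x b) x c - a x (b x c) - (a x c) x b + a x (c x b)`, polarised:
the inner product is `y`, the outer one is `x`. -/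
noncomputable def preLieRel {K : Type u} [Field K] (E : BinModule K) {p q : ℤ}
    (x : E.obj p) (y : E.obj q) (σ : Equiv.Perm (Fin 3)) : Quad E :=
  leftTree E x y σ - rightTree E x y σ
    - leftTree E x y (σ * Equiv.swap 1 2) + rightTree E x y (σ * Equiv.swap 1 2)

/-- The compatibility of a bracket `y` and a pre-Lie product `x`:
`y(a, b) x c + a x y(b, c) + b x y(a, c) - y(a, b x c) - y(b, a x c)`. -/
noncomputable def nijRel {K : Type u} [Field K] (E : BinModule K) {p q : ℤ}
    (x : E.obj p) (y : E.obj q) (σ : Equiv.Perm (Fin 3)) : Quad E :=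
  leftTree E x y σ + rightTree E x y σ + rightTree E x y (σ * Equiv.swap 0 1)
    - rightTree E y x σ - rightTree E y x (σ * Equiv.swap 0 1)

/-- The relations `R` of the bi-Nijenhuis operad; the labels `(a, b, c)` of the leaves are
`(σ 0, σ 1, σ 2)`. -/
def relR (K : Type u) [Field K] : Set (Quad (genM K)) :=
  {r | ∃ σ : Equiv.Perm (Fin 3),
    r = preLieRel (genM K) (mW K) (mW K) σ ∨
    r = preLieRel (genM K) (mB K) (mB K) σ ∨
    r = preLieRel (genM K) (mB K) (mW K) σ + preLieRel (genM K) (mW K) (mB K) σ ∨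
    r = leftTree (genM K) (mY K) (mY K) 1 + leftTree (genM K) (mY K) (mY K) (finRotate 3)
      + leftTree (genM K) (mY K) (mY K) (finRotate 3 * finRotate 3) ∨
    r = nijRel (genM K) (mW K) (mY K) σ ∨
    r = nijRel (genM K) (mB K) (mY K) σ}

/-- The presentation of the bi-Nijenhuis operad. -/
noncomputable def biNij (K : Type u) [Field K] : QuadraticData K where
  gens := genM K
  rels := Submodule.span K (relR K)

/-- The generators of the dual operad: the sign representation in degree `-1` (that is,
`sgn₂[1]`) and two copies of `K[𝕊₂] ⊗ sgn₂` in degree `0`. -/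
def genN (K : Type u) [Field K] : BinModule K :=
  (BinModule.inDegree
      (sgnTwist (Representation.trivial K (Equiv.Perm (Fin 2)) K)) (-1)).prod
    ((BinModule.inDegree (sgnTwist (regular K)) 0).prod
      (BinModule.inDegree (sgnTwist (regular K)) 0))

/-- The generator of `sgn₂[1]`. -/
def nY (K : Type u) [Field K] : (genN K).obj (-1) := (fun _ => 1, 0, 0)

/-- The generator of the first (white) copy of `K[𝕊₂] ⊗ sgn₂`. -/
def nW (K : Type u) [Field K] : (genN K).obj 0 := (0, fun _ => regOne K, 0)

/-- The generator of the second (black) copy of `K[𝕊₂] ⊗ sgn₂`. -/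
def nB (K : Type u) [Field K] : (genN K).obj 0 := (0, 0, fun _ => regOne K)

/-- The relations `S`; the labels `(a, b, c)` of the leaves are `(σ 0, σ 1, σ 2)`. In
`leftTree E x y` and `rightTree E x y` the root vertex is `x`. -/
def relS (K : Type u) [Field K] : Set (Quad (genN K)) :=
  {r | ∃ σ : Equiv.Perm (Fin 3),
    r = leftTree (genN K) (nW K) (nW K) σ - rightTree (genN K) (nW K) (nW K) σ ∨
    r = leftTree (genN K) (nW K) (nW K) σ
      - leftTree (genN K) (nW K) (nW K) (σ * Equiv.swap 1 2) ∨
    r = leftTree (genN K) (nB K) (nB K) σ - rightTree (genN K) (nB K) (nB K) σ ∨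
    r = leftTree (genN K) (nB K) (nB K) σ
      - leftTree (genN K) (nB K) (nB K) (σ * Equiv.swap 1 2) ∨
    r = leftTree (genN K) (nB K) (nW K) σ - rightTree (genN K) (nB K) (nW K) σ ∨
    r = leftTree (genN K) (nB K) (nW K) σ
      - leftTree (genN K) (nB K) (nW K) (σ * Equiv.swap 1 2) ∨
    r = leftTree (genN K) (nW K) (nB K) σ - rightTree (genN K) (nW K) (nB K) σ ∨
    r = leftTree (genN K) (nW K) (nB K) σ
      - leftTree (genN K) (nW K) (nB K) (σ * Equiv.swap 1 2) ∨
    r = leftTree (genN K) (nB K) (nW K) σ - leftTree (genN K) (nW K) (nB K) σ ∨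
    r = rightTree (genN K) (nB K) (nW K) σ - rightTree (genN K) (nW K) (nB K) σ ∨
    -- associativity of `nY`, which is skew and odd: the plus sign is the Koszul sign of
    -- exchanging two operations of degree `-1`
    r = leftTree (genN K) (nY K) (nY K) σ + rightTree (genN K) (nY K) (nY K) σ ∨
    r = leftTree (genN K) (nY K) (nW K) σ
      - leftTree (genN K) (nW K) (nY K) (σ * Equiv.swap 1 2) ∨
    r = rightTree (genN K) (nW K) (nY K) σ
      - leftTree (genN K) (nW K) (nY K) (σ * Equiv.swap 1 2)
      + leftTree (genN K) (nW K) (nY K) σ ∨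
    r = leftTree (genN K) (nY K) (nB K) σ
      - leftTree (genN K) (nB K) (nY K) (σ * Equiv.swap 1 2) ∨
    r = rightTree (genN K) (nB K) (nY K) σ
      - leftTree (genN K) (nB K) (nY K) (σ * Equiv.swap 1 2)
      + leftTree (genN K) (nB K) (nY K) σ}

/-- The quadratic operad with generators `N` and relations `S`. -/
noncomputable def biNijDual (K : Type u) [Field K] : QuadraticData K where
  gens := genN K
  rels := Submodule.span K (relS K)

/-- The functional on `M` dual to `mY`, an element of `M^∨` of degree `-1`. -/
def dualY (K : Type u) [Field K] : (genM K).czechDual.obj (-1) where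
  toFun := fun m => m.1 ⟨neg_neg 1⟩
  map_add' := fun _ _ => rfl
  map_smul' := fun _ _ => rfl

/-- The functional on `M` taking the coefficient of `mW` in the basis `mY`, `mW`, `(12) mW`,
`mB`, `(12) mB`. -/
def dualW (K : Type u) [Field K] : (genM K).czechDual.obj 0 where
  toFun := fun m => m.2.1 ⟨neg_zero⟩ 1
  map_add' := fun _ _ => rfl
  map_smul' := fun _ _ => rfl

/-- The functional on `M` taking the coefficient of `mB` in the basis `mY`, `mW`, `(12) mW`,
`mB`, `(12) mB`. -/
def dualB (K : Type u) [Field K] : (genM K).czechDual.obj 0 where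
  toFun := fun m => m.2.2 ⟨neg_zero⟩ 1
  map_add' := fun _ _ => rfl
  map_smul' := fun _ _ => rfl

end BiNijenhuis

open BiNijenhuis

/-!
Write `R` and `S` for the relators of the two operads, and transport `S` to the Koszul dual
generators along the isomorphism `N ≅ M^∨`. Two facts give `span S = R^⊥`. First, `S` and `R` are
orthogonal, by direct evaluation of the pairing. Second, every relator of `R` has a leading tree,
and the trees dual to the leading trees of the relators with an even labelling of the leaves form
a dual family to these relators. Modulo `S` these dual trees span the whole weight two part, so an
element of `R^⊥` is congruent modulo `S` to a combination of them, whose coefficients are its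
pairings with `R`, hence zero.

The isomorphism of quadratic operads follows because the free operad and its quotients are
functorial in isomorphisms of generators.
-/

namespace BiNijenhuis

section Functoriality

variable {K : Type u} [Field K]

/-- The inverse of an isomorphism of graded `𝕊₂`-modules. -/
def BinModule.Iso.symm {E F : BinModule K} (φ : E.Iso F) : F.Iso E where
  toEquiv := fun d => (φ.toEquiv d).symm
  map_rep := fun d σ x => by
    rw [LinearEquiv.symm_apply_eq, φ.map_rep, LinearEquiv.apply_symm_apply]

/-- The map on formal operadic expressions induced by an isomorphism of generators. -/
def Pre.map {E F : BinModule K} (φ : E.Iso F) : ∀ {n : ℕ} {d : ℤ}, Pre E n d → Pre F n d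
  | _, _, .gen x => .gen (φ.toEquiv _ x)
  | _, _, .one => .one
  | _, _, .zero => .zero
  | _, _, .add a b => .add (a.map φ) (b.map φ)
  | _, _, .smul c a => .smul c (a.map φ)
  | _, _, .act σ a => .act σ (a.map φ)
  | _, _, .comp i e h a b => .comp i e h (a.map φ) (b.map φ)

theorem Pre.map_symm_map {E F : BinModule K} (φ : E.Iso F) {n : ℕ} {d : ℤ} (a : Pre E n d) :
    (a.map φ).map φ.symm = a := by
  induction a <;> simp_all [Pre.map, BinModule.Iso.symm]

theorem Pre.map_map_symm {E F : BinModule K} (φ : E.Iso F) {n : ℕ} {d : ℤ} (a : Pre F n d) :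
    (a.map φ.symm).map φ = a := by
  induction a <;> simp_all [Pre.map, BinModule.Iso.symm]

theorem Rel.map {E F : BinModule K} (φ : E.Iso F) {n : ℕ} {d : ℤ} {a b : Pre E n d}
    (h : Rel E a b) : Rel F (a.map φ) (b.map φ) := by
  induction h with
  | symm _ ih => exact ih.symm
  | trans _ _ ih₁ ih₂ => exact ih₁.trans ih₂
  | gen_add => rw [Pre.map, map_add]; exact .gen_add _ _
  | gen_smul => rw [Pre.map, map_smul]; exact .gen_smul _ _
  | gen_act => rw [Pre.map, φ.map_rep]; exact .gen_act _ _
  | refl => exact .refl _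
  | add_congr _ _ iha ihb => exact .add_congr iha ihb
  | smul_congr c _ ih => exact .smul_congr c ih
  | act_congr σ _ ih => exact .act_congr σ ih
  | comp_congr i e h _ _ iha ihb => exact .comp_congr i e h iha ihb
  | add_comm => exact .add_comm _ _
  | add_assoc => exact .add_assoc _ _ _
  | zero_add => exact .zero_add _
  | one_smul => exact .one_smul _
  | zero_smul => exact .zero_smul _
  | mul_smul => exact .mul_smul _ _ _
  | add_smul => exact .add_smul _ _ _
  | smul_add => exact .smul_add _ _ _
  | act_add => exact .act_add _ _ _
  | act_smul => exact .act_smul _ _ _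
  | add_comp => exact .add_comp _ _ _ _ _ _
  | smul_comp => exact .smul_comp _ _ _ _ _ _
  | comp_add => exact .comp_add _ _ _ _ _ _
  | comp_smul => exact .comp_smul _ _ _ _ _ _
  | act_one => exact .act_one _
  | act_mul => exact .act_mul _ _ _
  | act_comp => exact .act_comp _ _ _ _ _ _
  | comp_act_right => exact .comp_act_right _ _ _ _ _ _
  | comp_act_left => apply Rel.comp_act_left; assumption
  | one_comp => apply Rel.one_comp; assumption
  | comp_one => apply Rel.comp_one; assumption
  | comp_assoc => apply Rel.comp_assoc; assumption
  | comp_comm => apply Rel.comp_comm; assumption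

/-- The isomorphism of free operads induced by an isomorphism of generators. -/
def freeIso {E F : BinModule K} (φ : E.Iso F) : (freeOperad E).Iso (freeOperad F) where
  toEquiv := fun n d =>
    { toFun := Quotient.map (Pre.map φ) (fun _ _ h => Rel.map φ h)
      invFun := Quotient.map (Pre.map φ.symm) (fun _ _ h => Rel.map φ.symm h)
      map_add' := by rintro ⟨a⟩ ⟨b⟩; rfl
      map_smul' := by rintro c ⟨a⟩; rfl
      left_inv := by rintro ⟨a⟩; exact congrArg FreeObj.mk (a.map_symm_map φ)
      right_inv := by rintro ⟨a⟩; exact congrArg FreeObj.mk (a.map_map_symm φ) }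
  map_one := rfl
  map_act := by rintro n d σ ⟨a⟩; rfl
  map_comp := by rintro m n k p q r i e h ⟨a⟩ ⟨b⟩; rfl

theorem freeIso_freeGen {E F : BinModule K} (φ : E.Iso F) (d : ℤ) (x : E.obj d) :
    (freeIso φ).toEquiv 2 d (freeGen E d x) = freeGen F d (φ.toEquiv d x) := rfl

/-- The inverse of an isomorphism of graded operads. -/
def GrOperad.Iso.symm {P Q : GrOperad K} (f : P.Iso Q) : Q.Iso P where
  toEquiv := fun n d => (f.toEquiv n d).symm
  map_one := by rw [LinearEquiv.symm_apply_eq, f.map_one]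
  map_act := fun σ a => by
    rw [LinearEquiv.symm_apply_eq, f.map_act, LinearEquiv.apply_symm_apply]
  map_comp := fun i e h a b => by
    rw [LinearEquiv.symm_apply_eq, f.map_comp, LinearEquiv.apply_symm_apply,
      LinearEquiv.apply_symm_apply]

theorem InIdeal.map {P Q : GrOperad K} (f : P.Iso Q) {X : ∀ n d, Set (P.obj n d)}
    {Y : ∀ n d, Set (Q.obj n d)} (hXY : ∀ n d, ∀ a ∈ X n d, f.toEquiv n d a ∈ Y n d)
    {n : ℕ} {d : ℤ} {a : P.obj n d} (ha : InIdeal P X a) : InIdeal Q Y (f.toEquiv n d a) := by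
  induction ha with
  | of a h => exact .of _ (hXY _ _ a h)
  | zero => rw [map_zero]; exact .zero
  | add a b _ _ iha ihb => rw [map_add]; exact .add _ _ iha ihb
  | smul c a _ ih => rw [map_smul]; exact .smul _ _ ih
  | act σ a _ ih => rw [f.map_act]; exact .act _ _ ih
  | comp_left i e h a b _ ih => rw [f.map_comp]; exact .comp_left _ _ _ _ _ ih
  | comp_right i e h a b _ ih => rw [f.map_comp]; exact .comp_right _ _ _ _ _ ih

/-- An isomorphism of operads identifying two families of relators induces an isomorphism of
the quotients. -/
def GrOperad.Iso.quot {P Q : GrOperad K} (f : P.Iso Q) (X : ∀ n d, Set (P.obj n d))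
    (Y : ∀ n d, Set (Q.obj n d)) (hXY : ∀ n d, ∀ a ∈ X n d, f.toEquiv n d a ∈ Y n d)
    (hYX : ∀ n d, ∀ b ∈ Y n d, (f.toEquiv n d).symm b ∈ X n d) :
    (P.quot X).Iso (Q.quot Y) where
  toEquiv := fun n d => Submodule.Quotient.equiv (genIdeal P X n d) (genIdeal Q Y n d)
    (f.toEquiv n d) (by
      apply le_antisymm
      · rintro _ ⟨a, ha, rfl⟩
        exact InIdeal.map f hXY ha
      · intro b hb
        exact ⟨_, InIdeal.map f.symm hYX hb, (f.toEquiv n d).apply_symm_apply b⟩)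
  map_one := congrArg Submodule.Quotient.mk f.map_one
  map_act := by
    intro n d σ a
    obtain ⟨a, rfl⟩ := Submodule.Quotient.mk_surjective _ a
    exact congrArg Submodule.Quotient.mk (f.map_act σ a)
  map_comp := by
    intro m n k p q r i e h a b
    obtain ⟨a, rfl⟩ := Submodule.Quotient.mk_surjective _ a
    obtain ⟨b, rfl⟩ := Submodule.Quotient.mk_surjective _ b
    exact congrArg Submodule.Quotient.mk (f.map_comp i e h a b)

theorem quadEval_quadMap {E F : BinModule K} (φ : E.Iso F) (r : Quad E) (d : ℤ) :
    quadEval F (quadMap φ r) d = (freeIso φ).toEquiv 3 d (quadEval E r d) := by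
  have key : (quadEval F).comp (quadMap φ) =
      (DirectSum.lmap fun d => ((freeIso φ).toEquiv 3 d).toLinearMap).comp (quadEval E) := by
    refine DirectSum.linearMap_ext _ fun s => TensorProduct.ext' fun x y => ?_
    simp only [LinearMap.comp_apply, quadMap, quadEval, DirectSum.lmap_lof,
      DirectSum.toModule_lof, TensorProduct.map_tmul, TensorProduct.lift.tmul,
      LinearMap.compl₁₂_apply, LinearEquiv.coe_coe, ← freeIso_freeGen, (freeIso φ).map_comp]
  exact congrArg (fun g : ⨁ d, (freeOperad F).obj 3 d => g d) (LinearMap.congr_fun key r)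

/-- An isomorphism of generators identifying the relations induces an isomorphism of quadratic
operads. -/
noncomputable def QuadraticData.operadIso (C D : QuadraticData K) (φ : C.gens.Iso D.gens)
    (h : C.rels.map (quadMap φ) = D.rels) : C.operad.Iso D.operad :=
  (freeIso φ).quot C.relators D.relators
    (by
      rintro n d a ha
      unfold QuadraticData.relators at ha ⊢
      split at ha
      · obtain ⟨r, hr, rfl⟩ := ha
        exact ⟨quadMap φ r, h ▸ Submodule.mem_map_of_mem hr, quadEval_quadMap φ r _⟩
      · exact ha.elim)
    (by
      rintro n d b hb
      unfold QuadraticData.relators at hb ⊢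
      split at hb
      · obtain ⟨r, hr, rfl⟩ := hb
        rw [← h] at hr
        obtain ⟨r, hr, rfl⟩ := hr
        exact ⟨r, hr, by rw [quadEval_quadMap, LinearEquiv.symm_apply_apply]⟩
      · exact hb.elim)

theorem QuadraticData.operadIso_gen (C D : QuadraticData K) (φ : C.gens.Iso D.gens)
    (h : C.rels.map (quadMap φ) = D.rels) (d : ℤ) (x : C.gens.obj d) :
    (C.operadIso D φ h).toEquiv 2 d (C.gen x) = D.gen (φ.toEquiv d x) := rfl

end Functoriality

section Duality

variable {K : Type u} [Field K]

/-- The composite of two isomorphisms of graded `𝕊₂`-modules. -/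
def BinModule.Iso.trans {E F G : BinModule K} (φ : E.Iso F) (ψ : F.Iso G) : E.Iso G where
  toEquiv d := (φ.toEquiv d).trans (ψ.toEquiv d)
  map_rep d σ x := by simp only [LinearEquiv.trans_apply, φ.map_rep, ψ.map_rep]

/-- The direct sum of two isomorphisms of graded `𝕊₂`-modules. -/
def BinModule.Iso.prodCongr {E E' F F' : BinModule K} (φ : E.Iso E') (ψ : F.Iso F') :
    (E.prod F).Iso (E'.prod F') where
  toEquiv d := (φ.toEquiv d).prodCongr (ψ.toEquiv d)
  map_rep d σ x := Prod.ext (φ.map_rep d σ x.1) (ψ.map_rep d σ x.2)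

/-- The Czech dual commutes with direct sums. -/
def BinModule.czechDualProd (E F : BinModule K) :
    (E.czechDual.prod F.czechDual).Iso (E.prod F).czechDual where
  toEquiv d := Module.dualProdDualEquivDual K (E.obj (-d)) (F.obj (-d))
  map_rep _ _ _ := LinearMap.ext fun _ => (mul_add _ _ _).symm

variable {V W : Type u} [AddCommGroup V] [Module K V] [AddCommGroup W] [Module K W]

/-- For equivalent propositions `P` and `Q`, the linear isomorphism from `V` (if `P` holds) or
`0` (otherwise) to the dual of `W` (if `Q` holds) or `0` (otherwise) that is induced by an
isomorphism `V ≃ W^*`. -/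
def dualOfIff (e : V ≃ₗ[K] Module.Dual K W) {P Q : Prop} [Decidable Q] (h : Q ↔ P) :
    (PLift P → V) ≃ₗ[K] Module.Dual K (PLift Q → W) :=
  (LinearEquiv.funCongrLeft K V (Equiv.plift.trans ((Equiv.ofIff h).trans Equiv.plift.symm))).trans
    ((LinearEquiv.piCongrRight fun _ => e).trans (LinearMap.lsum K (fun _ : PLift Q => W) K))

theorem dualOfIff_apply (e : V ≃ₗ[K] Module.Dual K W) {P Q : Prop} [Decidable Q] (h : Q ↔ P)
    (f : PLift P → V) (m : PLift Q → W) :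
    dualOfIff e h f m = ∑ q : PLift Q, e (f ⟨h.1 q.down⟩) (m q) := by
  simp [dualOfIff, LinearMap.lsum_apply, LinearEquiv.funCongrLeft_apply]

theorem dualOfIff_apply_of_true (e : V ≃ₗ[K] Module.Dual K W) {P Q : Prop} [Decidable Q]
    (h : Q ↔ P) (q : Q) (f : PLift P → V) (m : PLift Q → W) :
    dualOfIff e h f m = e (f ⟨h.1 q⟩) (m ⟨q⟩) :=
  (dualOfIff_apply e h f m).trans (Fintype.sum_eq_single (PLift.up q) fun _ hx => (hx rfl).elim)

/-- The Czech dual of a representation placed in degree `d` is the dual representation,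
twisted by the sign, placed in degree `-d`. -/
def BinModule.czechDualInDegree {ρ : Representation K (Equiv.Perm (Fin 2)) V}
    {ρ' : Representation K (Equiv.Perm (Fin 2)) W} (e : ρ.Equiv ρ'.dual) {d d' : ℤ}
    (h : d' = -d) :
    (BinModule.inDegree (sgnTwist ρ) d').Iso (BinModule.inDegree ρ' d).czechDual where
  toEquiv k := dualOfIff e.toLinearEquiv (by rw [h, neg_eq_iff_eq_neg])
  map_rep k σ f := LinearMap.ext fun m => by
    refine (dualOfIff_apply _ _ _ _).trans ?_
    refine Eq.trans ?_ (congrArg (((Equiv.Perm.sign σ : ℤ) : K) * ·)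
      (dualOfIff_apply _ _ _ _)).symm
    rw [Finset.mul_sum]
    refine Finset.sum_congr rfl fun q _ => ?_
    have equivariant (v : V) (w : W) : e.toLinearEquiv (ρ σ v) w =
        e.toLinearEquiv v (ρ' σ⁻¹ w) :=
      LinearMap.congr_fun (LinearMap.congr_fun (e.isIntertwining' σ) v) w
    exact (LinearMap.congr_fun (map_smul e.toLinearEquiv _ _) _).trans
      (congrArg _ (equivariant _ _))

end Duality

section DualGenerators

/-- The trivial representation of dimension one is self-dual. -/
def trivialEquivDual (K : Type u) [Field K] (G : Type*) [Group G] :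
    (Representation.trivial K G K).Equiv (Representation.trivial K G K).dual :=
  .mk (LinearMap.ringLmapEquivSelf K K K).symm fun _ => rfl

/-- The regular representation of `𝕊₂` is self-dual: the basis of group elements is mapped to
the dual basis. -/
noncomputable def regularEquivDual (K : Type u) [Field K] :
    (regular K).Equiv (regular K).dual :=
  .mk (LinearEquiv.piRing K K (Equiv.Perm (Fin 2)) K).symm fun σ => by
    refine LinearMap.ext fun f => LinearMap.ext fun g => ?_
    calc ∑ τ, g τ • f (σ⁻¹ * τ) = ∑ τ, g (σ * τ) • f (σ⁻¹ * (σ * τ)) :=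
          (Equiv.sum_comp (Equiv.mulLeft σ) _).symm
      _ = ∑ τ, g (σ⁻¹⁻¹ * τ) • f τ := by simp only [inv_inv, inv_mul_cancel_left]

variable {K : Type u} [Field K]

theorem regularEquivDual_regOne (f : Equiv.Perm (Fin 2) → K) :
    (regularEquivDual K).toLinearEquiv (regOne K) f = f 1 := by
  refine (LinearEquiv.piRing_symm_apply (S := K) _ _).trans ?_
  simp [regOne, Pi.single_apply]

/-- The isomorphism of graded `𝕊₂`-modules `N ≅ M^∨`. -/
noncomputable def dualIso (K : Type u) [Field K] : (genN K).Iso (genM K).czechDual :=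
  let regularIso := BinModule.czechDualInDegree (regularEquivDual K) (neg_zero (G := ℤ)).symm
  ((BinModule.czechDualInDegree (trivialEquivDual K _) rfl).prodCongr
    ((regularIso.prodCongr regularIso).trans (BinModule.czechDualProd _ _))).trans
      (BinModule.czechDualProd _ _)

theorem dualIso_apply (d : ℤ) (x : PLift (d = -1) → K)
    (y z : PLift (d = 0) → Equiv.Perm (Fin 2) → K) (x' : PLift (-d = 1) → K)
    (y' z' : PLift (-d = 0) → Equiv.Perm (Fin 2) → K) :
    (show Module.Dual K ((genM K).obj (-d)) from (dualIso K).toEquiv d (x, y, z)) (x', y', z') =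
      dualOfIff (trivialEquivDual K (Equiv.Perm (Fin 2))).toLinearEquiv neg_eq_iff_eq_neg x x' +
        (dualOfIff (regularEquivDual K).toLinearEquiv neg_eq_zero y y' +
          dualOfIff (regularEquivDual K).toLinearEquiv neg_eq_zero z z') := rfl

theorem dualIso_nY : (dualIso K).toEquiv (-1) (nY K) = dualY K := by
  have h x' y' z' := dualIso_apply (K := K) (-1) (fun _ => 1) 0 0 x' y' z'
  simp only [map_zero, LinearMap.zero_apply, add_zero,
    dualOfIff_apply_of_true _ _ (neg_neg (1 : ℤ))] at h
  exact LinearMap.ext fun m => (h m.1 m.2.1 m.2.2).trans (mul_one _)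

theorem dualIso_nW : (dualIso K).toEquiv 0 (nW K) = dualW K := by
  have h x' y' z' := dualIso_apply (K := K) 0 0 (fun _ => regOne K) 0 x' y' z'
  simp only [map_zero, LinearMap.zero_apply, add_zero, zero_add,
    dualOfIff_apply_of_true _ _ (neg_zero (G := ℤ)), regularEquivDual_regOne] at h
  exact LinearMap.ext fun m => h m.1 m.2.1 m.2.2

theorem dualIso_nB : (dualIso K).toEquiv 0 (nB K) = dualB K := by
  have h x' y' z' := dualIso_apply (K := K) 0 0 0 (fun _ => regOne K) x' y' z'
  simp only [map_zero, LinearMap.zero_apply, zero_add,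
    dualOfIff_apply_of_true _ _ (neg_zero (G := ℤ)), regularEquivDual_regOne] at h
  exact LinearMap.ext fun m => h m.1 m.2.1 m.2.2

end DualGenerators

section Trees

variable {K : Type u} [Field K]

theorem BinModule.rep_swap_swap (E : BinModule K) {d : ℤ} (x : E.obj d) :
    E.rep d (Equiv.swap 0 1) (E.rep d (Equiv.swap 0 1) x) = x := by
  rw [← Module.End.mul_apply, ← map_mul, Equiv.swap_mul_self, map_one, Module.End.one_apply]

theorem perm_fin_two_eq (τ : Equiv.Perm (Fin 2)) : τ = 1 ∨ τ = Equiv.swap 0 1 := by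
  revert τ; decide

theorem leftTree_swap_upper (E : BinModule K) {p q : ℤ} (x : E.obj p) (y : E.obj q)
    (σ : Equiv.Perm (Fin 3)) :
    leftTree E x (E.rep q (Equiv.swap 0 1) y) σ = leftTree E x y (σ * Equiv.swap 0 1) := by
  have swap_apply : Equiv.swap (0 : Fin 3) 1 2 = 2 := by decide
  have sign_mul : Equiv.Perm.sign (σ * Equiv.swap 0 1) = -Equiv.Perm.sign σ := by
    rw [Equiv.Perm.sign_mul, Equiv.Perm.sign_swap (by decide), mul_neg_one]
  unfold leftTree
  rw [Equiv.Perm.mul_apply, swap_apply, sign_mul]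
  rcases Int.units_eq_one_or (Equiv.Perm.sign σ) with h | h <;>
    simp [h, E.rep_swap_swap]

theorem leftTree_swap_root (E : BinModule K) {p q : ℤ} (x : E.obj p) (y : E.obj q)
    (σ : Equiv.Perm (Fin 3)) :
    leftTree E (E.rep p (Equiv.swap 0 1) x) y σ = rightTree E x y (σ * (finRotate 3)⁻¹) := by
  rw [rightTree, inv_mul_cancel_right]

theorem quadMap_leftTree {E F : BinModule K} (φ : E.Iso F) {p q : ℤ} (x : E.obj p) (y : E.obj q)
    (σ : Equiv.Perm (Fin 3)) :
    quadMap φ (leftTree E x y σ) = leftTree F (φ.toEquiv p x) (φ.toEquiv q y) σ := by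
  refine (DirectSum.lmap_lof _ _ _).trans (congrArg _ ?_)
  refine (TensorProduct.map_tmul _ _ _ _).trans (congrArg _ ?_)
  exact (apply_ite (φ.toEquiv q) _ _ _).trans
    (congrArg (ite _ _) (φ.map_rep q _ y))

theorem quadMap_rightTree {E F : BinModule K} (φ : E.Iso F) {p q : ℤ} (x : E.obj p)
    (y : E.obj q) (σ : Equiv.Perm (Fin 3)) :
    quadMap φ (rightTree E x y σ) = rightTree F (φ.toEquiv p x) (φ.toEquiv q y) σ := by
  rw [rightTree, quadMap_leftTree, φ.map_rep, rightTree]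

end Trees

section Pairing

variable {K : Type u} [Field K] {E : BinModule K}

/-- The value of a functional in `E^∨` of any degree on an element of `E` of any degree, which is
zero unless the degrees are opposite. -/
def BinModule.eval {d e : ℤ} (f : E.czechDual.obj d) (x : E.obj e) : K :=
  if h : e = -d then (show Module.Dual K (E.obj (-d)) from f) (h ▸ x) else 0

theorem BinModule.eval_self {d : ℤ} (f : E.czechDual.obj d) (x : E.obj (-d)) :
    BinModule.eval f x = (show Module.Dual K (E.obj (-d)) from f) x :=
  dif_pos rfl

theorem BinModule.eval_of_ne {d e : ℤ} (h : e ≠ -d) (f : E.czechDual.obj d) (x : E.obj e) :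
    BinModule.eval f x = 0 :=
  dif_neg h

theorem BinModule.eval_swap_left {d e : ℤ} (f : E.czechDual.obj d) (x : E.obj e) :
    BinModule.eval (E.czechDual.rep d (Equiv.swap 0 1) f) x =
      -BinModule.eval f (E.rep e (Equiv.swap 0 1) x) := by
  by_cases h : e = -d
  · subst h
    rw [BinModule.eval_self, BinModule.eval_self]
    have sign_swap : ((Equiv.Perm.sign (Equiv.swap (0 : Fin 2) 1) : ℤ) : K) = -1 := by simp
    exact (congrArg (· * _) sign_swap).trans (neg_one_mul _)
  · rw [BinModule.eval_of_ne h, BinModule.eval_of_ne h, neg_zero]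

theorem quadPairing_lof_tmul {p q p' q' : ℤ} (t t' : Fin 3) (f : E.czechDual.obj p)
    (g : E.czechDual.obj q) (x : E.obj p') (y : E.obj q') :
    quadPairing E
        (DirectSum.lof K (Fin 3 × ℤ × ℤ)
          (fun s => E.czechDual.obj s.2.1 ⊗[K] E.czechDual.obj s.2.2) (t, p, q) (f ⊗ₜ g))
        (DirectSum.lof K (Fin 3 × ℤ × ℤ)
          (fun s => E.obj s.2.1 ⊗[K] E.obj s.2.2) (t', p', q') (x ⊗ₜ y)) =
      if t = t' then BinModule.eval f x * BinModule.eval g y else 0 := by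
  rw [quadPairing, DirectSum.toModule_lof]
  by_cases h : (t', p', q') = (t, -p, -q)
  · obtain ⟨rfl, rfl, rfl⟩ : t' = t ∧ p' = -p ∧ q' = -q := by simpa using h
    rw [if_pos rfl, BinModule.eval_self, BinModule.eval_self]
    refine (congrArg (TensorProduct.dualDistrib K (E.obj (-p)) (E.obj (-q)) _)
      (DirectSum.component.lof_self (R := K) (M := fun s : Fin 3 × ℤ × ℤ =>
        E.obj s.2.1 ⊗[K] E.obj s.2.2) (t', -p, -q) _)).trans ?_
    exact TensorProduct.dualDistrib_apply (R := K) _ _ _ _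
  · have value_zero : (if t = t' then BinModule.eval f x * BinModule.eval g y else 0) = 0 := by
      by_cases hp : p' = -p
      · by_cases hq : q' = -q
        · rw [if_neg fun ht => h (by rw [ht, hp, hq])]
        · rw [BinModule.eval_of_ne hq, mul_zero, ite_self]
      · rw [BinModule.eval_of_ne hp, zero_mul, ite_self]
    rw [value_zero]
    refine (congrArg (TensorProduct.dualDistrib K (E.obj (-p)) (E.obj (-q)) _)
      ((DirectSum.component.of (R := K) (M := fun s : Fin 3 × ℤ × ℤ =>
        E.obj s.2.1 ⊗[K] E.obj s.2.2) (t, -p, -q) (t', p', q') _).trans (dif_neg h))).trans ?_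
    exact map_zero _

/-- The sign of `σ` if `σ = τ`, and zero otherwise. -/
def signedDelta (σ τ : Equiv.Perm (Fin 3)) : ℤ :=
  if σ = τ then Equiv.Perm.sign σ else 0

theorem quadPairing_leftTree {p q p' q' : ℤ} (f : E.czechDual.obj p) (g : E.czechDual.obj q)
    (x : E.obj p') (y : E.obj q') (σ τ : Equiv.Perm (Fin 3)) :
    quadPairing E (leftTree E.czechDual f g σ) (leftTree E x y τ) =
      BinModule.eval f x * (signedDelta σ τ * BinModule.eval g y -
        signedDelta (σ * Equiv.swap 0 1) τ *
          BinModule.eval g (E.rep q' (Equiv.swap 0 1) y)) := by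
  have swap_apply : Equiv.swap (0 : Fin 3) 1 2 = 2 := by decide
  have swap_ne : σ * Equiv.swap 0 1 ≠ σ := by simp [mul_eq_left]
  have sign_mul : Equiv.Perm.sign (σ * Equiv.swap 0 1) = -Equiv.Perm.sign σ := by
    rw [Equiv.Perm.sign_mul, Equiv.Perm.sign_swap (by decide), mul_neg_one]
  have same_root : σ 2 = τ 2 ↔ σ = τ ∨ σ * Equiv.swap 0 1 = τ := by
    revert σ τ; decide
  rw [leftTree, leftTree, quadPairing_lof_tmul]
  by_cases h : σ = τ
  · subst h
    rcases Int.units_eq_one_or (Equiv.Perm.sign σ) with hσ | hσ <;>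
      simp [signedDelta, swap_ne, hσ, BinModule.eval_swap_left, E.rep_swap_swap]
  by_cases h' : σ * Equiv.swap 0 1 = τ
  · subst h'
    rcases Int.units_eq_one_or (Equiv.Perm.sign σ) with hσ | hσ <;>
      simp [signedDelta, swap_ne.symm, hσ, swap_apply, BinModule.eval_swap_left]
  · rw [if_neg (by simp [same_root, h, h'])]
    simp [signedDelta, h, h']

end Pairing

section Generators

variable (K : Type u) [Field K]

/-- The degrees of the generators `[,]` (the index `none`), `∘` (the index `some false`) and `•`
(the index `some true`) of `M`. -/
def degM : Option Bool → ℤ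
  | none => 1
  | some _ => 0

/-- The degrees of the generators `ν`, `∘`, `•` of `N`, with the same indices as in `degM`. -/
def degN : Option Bool → ℤ
  | none => -1
  | some _ => 0

/-- The natural generators of `M`, indexed as in `degM`. -/
def generatorM : ∀ i, (genM K).obj (degM i)
  | none => mY K
  | some false => mW K
  | some true => mB K

/-- The natural generators of `N`, indexed as in `degM`. -/
def generatorN : ∀ i, (genN K).obj (degN i)
  | none => nY K
  | some false => nW K
  | some true => nB K

/-- The functionals dual to the natural generators of `M`, indexed as in `degM`. -/
def generatorDual : ∀ i, (genM K).czechDual.obj (degN i)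
  | none => dualY K
  | some false => dualW K
  | some true => dualB K

variable {K}

theorem dualIso_generatorN (i : Option Bool) :
    (dualIso K).toEquiv (degN i) (generatorN K i) = generatorDual K i :=
  match i with
  | none => dualIso_nY
  | some false => dualIso_nW
  | some true => dualIso_nB

theorem rep_dualY_swap :
    (genM K).czechDual.rep (-1) (Equiv.swap 0 1) (dualY K) = -dualY K := by
  have sign_swap : ((Equiv.Perm.sign (Equiv.swap (0 : Fin 2) 1) : ℤ) : K) = -1 := by simp
  exact LinearMap.ext fun m => (congrArg (· * _) sign_swap).trans (neg_one_mul _)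

theorem eval_generatorDual (i j : Option Bool) :
    BinModule.eval (generatorDual K i) (generatorM K j) = if i = j then 1 else 0 := by
  have regOne_one : regOne K 1 = 1 := Pi.single_eq_same _ _
  rcases i with _ | _ | _ <;> rcases j with _ | _ | _
  case none.none => exact BinModule.eval_self (dualY K) (mY K)
  case some.false.some.false => exact (BinModule.eval_self (dualW K) (mW K)).trans regOne_one
  case some.true.some.true => exact (BinModule.eval_self (dualB K) (mB K)).trans regOne_one
  case some.false.some.true => exact BinModule.eval_self (dualW K) (mB K)
  case some.true.some.false => exact BinModule.eval_self (dualB K) (mW K)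
  all_goals exact BinModule.eval_of_ne (by decide) _ _

theorem eval_generatorDual_swap (i j : Option Bool) :
    BinModule.eval (generatorDual K i) ((genM K).rep (degM j) (Equiv.swap 0 1) (generatorM K j)) =
      if i = j ∧ i = none then 1 else 0 := by
  have regOne_swap : regOne K ((Equiv.swap 0 1)⁻¹ * 1) = 0 := Pi.single_eq_of_ne (by decide) _
  rcases i with _ | _ | _ <;> rcases j with _ | _ | _
  case none.none => exact BinModule.eval_self (dualY K) (mY K)
  case some.false.some.false => exact (BinModule.eval_self (dualW K) _).trans regOne_swap
  case some.true.some.true => exact (BinModule.eval_self (dualB K) _).trans regOne_swap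
  case some.false.some.true => exact BinModule.eval_self (dualW K) (mB K)
  case some.true.some.false => exact BinModule.eval_self (dualB K) (mW K)
  all_goals exact BinModule.eval_of_ne (by decide) _ _

end Generators

section Relations

variable {K : Type u} [Field K] {E F : BinModule K} {deg : Option Bool → ℤ}

/-- Indices of the relations `S` of the dual operad. The Boolean arguments are the colours of the
products involved, as in `degM`, and the permutation is the labelling of the leaves. -/
inductive DualRelIndex
  | assoc (x y : Bool) (σ : Equiv.Perm (Fin 3))
  | perm (x y : Bool) (σ : Equiv.Perm (Fin 3))
  | left (σ : Equiv.Perm (Fin 3))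
  | right (σ : Equiv.Perm (Fin 3))
  | odd (σ : Equiv.Perm (Fin 3))
  | bracket (x : Bool) (σ : Equiv.Perm (Fin 3))
  | leibniz (x : Bool) (σ : Equiv.Perm (Fin 3))

/-- The relations `S`, stated for arbitrary operations `g none`, `g (some false)` and
`g (some true)` in place of `ν`, `∘` and `•`. -/
noncomputable def dualRel (g : ∀ i, E.obj (deg i)) : DualRelIndex → Quad E
  | .assoc x y σ => leftTree E (g (some x)) (g (some y)) σ - rightTree E (g (some x)) (g (some y)) σ
  | .perm x y σ => leftTree E (g (some x)) (g (some y)) σ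
      - leftTree E (g (some x)) (g (some y)) (σ * Equiv.swap 1 2)
  | .left σ => leftTree E (g (some true)) (g (some false)) σ
      - leftTree E (g (some false)) (g (some true)) σ
  | .right σ => rightTree E (g (some true)) (g (some false)) σ
      - rightTree E (g (some false)) (g (some true)) σ
  | .odd σ => leftTree E (g none) (g none) σ + rightTree E (g none) (g none) σ
  | .bracket x σ => leftTree E (g none) (g (some x)) σ
      - leftTree E (g (some x)) (g none) (σ * Equiv.swap 1 2)
  | .leibniz x σ => rightTree E (g (some x)) (g none) σ
      - leftTree E (g (some x)) (g none) (σ * Equiv.swap 1 2)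
      + leftTree E (g (some x)) (g none) σ

theorem relS_eq_range : relS K = Set.range (dualRel (generatorN K)) := by
  ext r
  constructor
  · rintro ⟨σ, h | h | h | h | h | h | h | h | h | h | h | h | h | h | h⟩
    exacts [⟨.assoc false false σ, h.symm⟩, ⟨.perm false false σ, h.symm⟩,
      ⟨.assoc true true σ, h.symm⟩, ⟨.perm true true σ, h.symm⟩,
      ⟨.assoc true false σ, h.symm⟩, ⟨.perm true false σ, h.symm⟩,
      ⟨.assoc false true σ, h.symm⟩, ⟨.perm false true σ, h.symm⟩,
      ⟨.left σ, h.symm⟩, ⟨.right σ, h.symm⟩, ⟨.odd σ, h.symm⟩,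
      ⟨.bracket false σ, h.symm⟩, ⟨.leibniz false σ, h.symm⟩,
      ⟨.bracket true σ, h.symm⟩, ⟨.leibniz true σ, h.symm⟩]
  · rintro ⟨⟨_ | _, _ | _, σ⟩ | ⟨_ | _, _ | _, σ⟩ | σ | σ | σ | ⟨_ | _, σ⟩ | ⟨_ | _, σ⟩, rfl⟩ <;>
      exact ⟨σ, by simp only [dualRel, generatorN, degN, true_or, or_true]⟩

theorem quadMap_dualRel (φ : E.Iso F) (g : ∀ i, E.obj (deg i)) (j : DualRelIndex) :
    quadMap φ (dualRel g j) = dualRel (fun i => φ.toEquiv (deg i) (g i)) j := by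
  cases j <;> simp only [dualRel, map_add, map_sub, quadMap_leftTree, quadMap_rightTree]

theorem map_span_relS : (Submodule.span K (relS K)).map (quadMap (dualIso K)) =
    Submodule.span K (Set.range (dualRel (generatorDual K))) := by
  rw [relS_eq_range, Submodule.map_span, ← Set.range_comp]
  refine congrArg (fun g => Submodule.span K (Set.range g)) (funext fun j => ?_)
  exact (quadMap_dualRel _ _ j).trans (by simp only [dualIso_generatorN])

/-- Indices of the relations `R` of the bi-Nijenhuis operad. The Boolean argument is the colour of
the product involved, as in `degM`, and the permutation is the labelling of the leaves. -/
inductive RelIndex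
  | preLie (x : Bool) (σ : Equiv.Perm (Fin 3))
  | mixed (σ : Equiv.Perm (Fin 3))
  | jacobi
  | nijenhuis (x : Bool) (σ : Equiv.Perm (Fin 3))
  deriving DecidableEq

/-- The relations `R`. -/
noncomputable def rel (K : Type u) [Field K] : RelIndex → Quad (genM K)
  | .preLie x σ => preLieRel (genM K) (generatorM K (some x)) (generatorM K (some x)) σ
  | .mixed σ => preLieRel (genM K) (generatorM K (some true)) (generatorM K (some false)) σ
      + preLieRel (genM K) (generatorM K (some false)) (generatorM K (some true)) σ
  | .jacobi => leftTree (genM K) (generatorM K none) (generatorM K none) 1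
      + leftTree (genM K) (generatorM K none) (generatorM K none) (finRotate 3)
      + leftTree (genM K) (generatorM K none) (generatorM K none) (finRotate 3 * finRotate 3)
  | .nijenhuis x σ => nijRel (genM K) (generatorM K (some x)) (generatorM K none) σ

theorem relR_eq_range : relR K = Set.range (rel K) := by
  ext r
  constructor
  · rintro ⟨σ, h | h | h | h | h | h⟩
    exacts [⟨.preLie false σ, h.symm⟩, ⟨.preLie true σ, h.symm⟩, ⟨.mixed σ, h.symm⟩,
      ⟨.jacobi, h.symm⟩, ⟨.nijenhuis false σ, h.symm⟩, ⟨.nijenhuis true σ, h.symm⟩]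
  · rintro ⟨⟨_ | _, σ⟩ | σ | _ | ⟨_ | _, σ⟩, rfl⟩
    exacts [⟨σ, .inl rfl⟩, ⟨σ, .inr (.inl rfl)⟩, ⟨σ, .inr (.inr (.inl rfl))⟩,
      ⟨1, .inr (.inr (.inr (.inl rfl)))⟩, ⟨σ, .inr (.inr (.inr (.inr (.inl rfl))))⟩,
      ⟨σ, .inr (.inr (.inr (.inr (.inr rfl))))⟩]

end Relations

section Orthogonality

variable {K : Type u} [Field K]

theorem quadPairing_leftTree_leftTree (i j k l : Option Bool) (σ τ : Equiv.Perm (Fin 3)) :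
    quadPairing (genM K)
        (leftTree _ (generatorDual K i) (generatorDual K j) σ)
        (leftTree _ (generatorM K k) (generatorM K l) τ) =
      if i = k ∧ j = l then
        ((signedDelta σ τ - if j = none then signedDelta (σ * Equiv.swap 0 1) τ else 0 : ℤ) : K)
      else 0 := by
  rw [quadPairing_leftTree, eval_generatorDual, eval_generatorDual, eval_generatorDual_swap]
  split_ifs <;> simp_all

theorem quadPairing_leftTree_rightTree (i j k l : Option Bool) (σ τ : Equiv.Perm (Fin 3)) :
    quadPairing (genM K)
        (leftTree _ (generatorDual K i) (generatorDual K j) σ)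
        (rightTree _ (generatorM K k) (generatorM K l) τ) =
      if i = none ∧ k = none ∧ j = l then
        ((signedDelta σ (τ * finRotate 3) -
          if j = none then signedDelta (σ * Equiv.swap 0 1) (τ * finRotate 3) else 0 : ℤ) : K)
      else 0 := by
  rw [rightTree, quadPairing_leftTree, eval_generatorDual_swap, eval_generatorDual,
    eval_generatorDual_swap]
  split_ifs <;> grind

theorem quadPairing_rightTree_leftTree (i j k l : Option Bool) (σ τ : Equiv.Perm (Fin 3)) :
    quadPairing (genM K)
        (rightTree _ (generatorDual K i) (generatorDual K j) σ)
        (leftTree _ (generatorM K k) (generatorM K l) τ) =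
      if i = none ∧ k = none ∧ j = l then
        ((-(signedDelta (σ * finRotate 3) τ -
          if j = none then signedDelta (σ * finRotate 3 * Equiv.swap 0 1) τ else 0) : ℤ) : K)
      else 0 := by
  rw [rightTree, quadPairing_leftTree, BinModule.eval_swap_left, eval_generatorDual_swap,
    eval_generatorDual, eval_generatorDual_swap]
  split_ifs <;> grind

theorem quadPairing_rightTree_rightTree (i j k l : Option Bool) (σ τ : Equiv.Perm (Fin 3)) :
    quadPairing (genM K)
        (rightTree _ (generatorDual K i) (generatorDual K j) σ)
        (rightTree _ (generatorM K k) (generatorM K l) τ) =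
      if i = k ∧ j = l then
        ((-(signedDelta (σ * finRotate 3) (τ * finRotate 3) - if j = none then
          signedDelta (σ * finRotate 3 * Equiv.swap 0 1) (τ * finRotate 3) else 0) : ℤ) : K)
      else 0 := by
  rw [rightTree, rightTree, quadPairing_leftTree, BinModule.eval_swap_left,
    BinModule.rep_swap_swap, eval_generatorDual, eval_generatorDual, eval_generatorDual_swap]
  split_ifs <;> simp_all

/-- The pairing of a tree labelled by `σ` with a pre-Lie relator labelled by `τ`, for the same
generators. -/
def preLieDelta (σ τ : Equiv.Perm (Fin 3)) : ℤ :=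
  signedDelta σ τ - signedDelta σ (τ * Equiv.swap 1 2)

theorem preLieDelta_mul_swap (σ τ : Equiv.Perm (Fin 3)) :
    preLieDelta (σ * Equiv.swap 1 2) τ = preLieDelta σ τ := by
  revert σ τ; decide

theorem quadPairing_leftTree_preLieRel (i j : Option Bool) (x y : Bool)
    (σ τ : Equiv.Perm (Fin 3)) :
    quadPairing (genM K)
        (leftTree _ (generatorDual K i) (generatorDual K j) σ)
        (preLieRel _ (generatorM K (some x)) (generatorM K (some y)) τ) =
      if i = some x ∧ j = some y then (preLieDelta σ τ : K) else 0 := by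
  simp only [preLieRel, map_add, map_sub, quadPairing_leftTree_leftTree,
    quadPairing_leftTree_rightTree, preLieDelta]
  split_ifs <;> simp_all

theorem quadPairing_rightTree_preLieRel (i j : Option Bool) (x y : Bool)
    (σ τ : Equiv.Perm (Fin 3)) :
    quadPairing (genM K)
        (rightTree _ (generatorDual K i) (generatorDual K j) σ)
        (preLieRel _ (generatorM K (some x)) (generatorM K (some y)) τ) =
      if i = some x ∧ j = some y then (preLieDelta σ τ : K) else 0 := by
  have rotate : preLieDelta σ τ = signedDelta (σ * finRotate 3) (τ * finRotate 3) -
      signedDelta (σ * finRotate 3) (τ * Equiv.swap 1 2 * finRotate 3) := by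
    revert σ τ; decide
  rw [rotate]
  simp only [preLieRel, map_add, map_sub, quadPairing_rightTree_leftTree,
    quadPairing_rightTree_rightTree]
  split_ifs <;> simp_all [sub_eq_add_neg]

/-- The pairing of a tree of shape `u(ν(a, b), c)` labelled by `σ` with the compatibility
relator of `[,]` and the dual product of `u`, labelled by `τ`. -/
def nijDelta (σ τ : Equiv.Perm (Fin 3)) : ℤ :=
  signedDelta σ τ - signedDelta (σ * Equiv.swap 0 1) τ

theorem quadPairing_leftTree_nijRel (i j : Option Bool) (x : Bool) (σ τ : Equiv.Perm (Fin 3)) :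
    quadPairing (genM K)
        (leftTree _ (generatorDual K i) (generatorDual K j) σ)
        (nijRel _ (generatorM K (some x)) (generatorM K none) τ) =
      if i = some x ∧ j = none then (nijDelta σ τ : K)
      else if i = none ∧ j = some x then (nijDelta (σ * Equiv.swap 1 2) τ : K) else 0 := by
  have bracket_root : nijDelta (σ * Equiv.swap 1 2) τ = -signedDelta σ (τ * finRotate 3) -
      signedDelta σ (τ * Equiv.swap 0 1 * finRotate 3) := by
    revert σ τ; decide
  rw [bracket_root]
  simp only [nijRel, map_add, map_sub, quadPairing_leftTree_leftTree,
    quadPairing_leftTree_rightTree, nijDelta]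
  split_ifs <;> simp_all

theorem quadPairing_rightTree_nijRel (i j : Option Bool) (x : Bool) (σ τ : Equiv.Perm (Fin 3)) :
    quadPairing (genM K)
        (rightTree _ (generatorDual K i) (generatorDual K j) σ)
        (nijRel _ (generatorM K (some x)) (generatorM K none) τ) =
      if i = some x ∧ j = none then ((nijDelta (σ * Equiv.swap 1 2) τ - nijDelta σ τ : ℤ) : K)
      else if i = none ∧ j = some x then
        ((-nijDelta (σ * finRotate 3 * Equiv.swap 1 2) τ : ℤ) : K)
      else 0 := by
  have product_root : nijDelta (σ * Equiv.swap 1 2) τ - nijDelta σ τ =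
      -(signedDelta (σ * finRotate 3) (τ * finRotate 3) -
        signedDelta (σ * finRotate 3 * Equiv.swap 0 1) (τ * finRotate 3)) -
      (signedDelta (σ * finRotate 3) (τ * Equiv.swap 0 1 * finRotate 3) -
        signedDelta (σ * finRotate 3 * Equiv.swap 0 1) (τ * Equiv.swap 0 1 * finRotate 3)) := by
    revert σ τ; decide
  have bracket_root : -nijDelta (σ * finRotate 3 * Equiv.swap 1 2) τ =
      signedDelta (σ * finRotate 3) (τ * finRotate 3) +
      signedDelta (σ * finRotate 3) (τ * Equiv.swap 0 1 * finRotate 3) := by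
    revert σ τ; decide
  rw [product_root, bracket_root]
  simp only [nijRel, map_add, map_sub, quadPairing_rightTree_leftTree,
    quadPairing_rightTree_rightTree]
  split_ifs <;> simp_all [sub_eq_add_neg]

theorem quadPairing_leftTree_jacobi (i j : Option Bool) (σ : Equiv.Perm (Fin 3)) :
    quadPairing (genM K)
        (leftTree _ (generatorDual K i) (generatorDual K j) σ) (rel K .jacobi) =
      if i = none ∧ j = none then ((Equiv.Perm.sign σ : ℤ) : K) else 0 := by
  have total : (Equiv.Perm.sign σ : ℤ) =
      (signedDelta σ 1 - signedDelta (σ * Equiv.swap 0 1) 1) +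
      (signedDelta σ (finRotate 3) - signedDelta (σ * Equiv.swap 0 1) (finRotate 3)) +
      (signedDelta σ (finRotate 3 * finRotate 3) -
        signedDelta (σ * Equiv.swap 0 1) (finRotate 3 * finRotate 3)) := by
    revert σ; decide
  rw [total]
  simp only [rel, map_add, quadPairing_leftTree_leftTree]
  split_ifs <;> simp_all

theorem quadPairing_rightTree_jacobi (i j : Option Bool) (σ : Equiv.Perm (Fin 3)) :
    quadPairing (genM K)
        (rightTree _ (generatorDual K i) (generatorDual K j) σ) (rel K .jacobi) =
      if i = none ∧ j = none then ((-Equiv.Perm.sign σ : ℤ) : K) else 0 := by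
  have total : (-Equiv.Perm.sign σ : ℤ) =
      -(signedDelta (σ * finRotate 3) 1 - signedDelta (σ * finRotate 3 * Equiv.swap 0 1) 1) +
      -(signedDelta (σ * finRotate 3) (finRotate 3) -
        signedDelta (σ * finRotate 3 * Equiv.swap 0 1) (finRotate 3)) +
      -(signedDelta (σ * finRotate 3) (finRotate 3 * finRotate 3) -
        signedDelta (σ * finRotate 3 * Equiv.swap 0 1) (finRotate 3 * finRotate 3)) := by
    revert σ; decide
  rw [total]
  simp only [rel, map_add, quadPairing_rightTree_leftTree]
  split_ifs <;> simp_all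

theorem quadPairing_dualRel_rel (s : DualRelIndex) (r : RelIndex) :
    quadPairing (genM K) (dualRel (generatorDual K) s) (rel K r) = 0 := by
  cases r with
  | jacobi =>
    cases s <;> simp [dualRel, quadPairing_leftTree_jacobi, quadPairing_rightTree_jacobi]
  | preLie x τ =>
    cases s <;> simp [dualRel, rel, quadPairing_leftTree_preLieRel,
      quadPairing_rightTree_preLieRel, preLieDelta_mul_swap]
  | mixed τ =>
    cases s <;> simp [dualRel, rel, quadPairing_leftTree_preLieRel,
      quadPairing_rightTree_preLieRel, preLieDelta_mul_swap]
  | nijenhuis x τ =>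
    cases s with
    | leibniz y σ =>
      simp only [dualRel, rel, map_add, map_sub, LinearMap.add_apply, LinearMap.sub_apply,
        quadPairing_leftTree_nijRel, quadPairing_rightTree_nijRel]
      split_ifs <;> simp_all
    | _ =>
      simp [dualRel, rel, quadPairing_leftTree_nijRel, quadPairing_rightTree_nijRel]

end Orthogonality

section Generation

variable {K : Type u} [Field K] {E F : BinModule K}

/-- The elements `g i` generate `E`: no proper graded subrepresentation contains them all. -/
def BinModule.IsGeneratedBy (E : BinModule K) {ι : Type*} {deg : ι → ℤ}
    (g : ∀ i, E.obj (deg i)) : Prop :=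
  ∀ W : ∀ d, Submodule K (E.obj d), (∀ d σ, W d ≤ (W d).comap (E.rep d σ)) →
    (∀ i, g i ∈ W (deg i)) → ∀ d, W d = ⊤

theorem BinModule.IsGeneratedBy.map {ι : Type*} {deg : ι → ℤ} {g : ∀ i, E.obj (deg i)}
    (hg : E.IsGeneratedBy g) (φ : E.Iso F) :
    F.IsGeneratedBy fun i => φ.toEquiv (deg i) (g i) := by
  intro W stable mem d
  have comap_top := hg (fun d => (W d).comap (φ.toEquiv d).toLinearMap)
    (fun d σ x hx => by
      simpa only [Submodule.mem_comap, LinearEquiv.coe_coe, φ.map_rep] using stable d σ hx)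
    mem d
  refine Submodule.eq_top_iff'.2 fun y => ?_
  obtain ⟨x, rfl⟩ := (φ.toEquiv d).surjective y
  exact Submodule.eq_top_iff'.1 comap_top x

/-- The tree monomial `leftTree` as a bilinear map in its two decorations. -/
noncomputable def leftTreeHom (E : BinModule K) (p q : ℤ) (σ : Equiv.Perm (Fin 3)) :
    E.obj p →ₗ[K] E.obj q →ₗ[K] Quad E :=
  ((TensorProduct.mk K (E.obj p) (E.obj q)).compr₂
    (DirectSum.lof K (Fin 3 × ℤ × ℤ) (fun s => E.obj s.2.1 ⊗[K] E.obj s.2.2) (σ 2, p, q))).compl₂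
      (if Equiv.Perm.sign σ = 1 then LinearMap.id else E.rep q (Equiv.swap 0 1))

theorem leftTreeHom_apply {p q : ℤ} (x : E.obj p) (y : E.obj q) (σ : Equiv.Perm (Fin 3)) :
    leftTreeHom E p q σ x y = leftTree E x y σ := by
  rw [leftTreeHom, leftTree, LinearMap.compl₂_apply, LinearMap.compr₂_apply,
    TensorProduct.mk_apply]
  split_ifs <;> rfl

theorem leftTree_neg_left {p q : ℤ} (x : E.obj p) (y : E.obj q) (σ : Equiv.Perm (Fin 3)) :
    leftTree E (-x) y σ = -leftTree E x y σ := by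
  rw [← leftTreeHom_apply, map_neg, LinearMap.neg_apply, leftTreeHom_apply]

theorem leftTree_neg_right {p q : ℤ} (x : E.obj p) (y : E.obj q) (σ : Equiv.Perm (Fin 3)) :
    leftTree E x (-y) σ = -leftTree E x y σ := by
  rw [← leftTreeHom_apply, map_neg, leftTreeHom_apply]

theorem eq_top_of_forall_leftTree_mem {W : Submodule K (Quad E)}
    (h : ∀ (p q : ℤ) (x : E.obj p) (y : E.obj q) (σ : Equiv.Perm (Fin 3)),
      leftTree E x y σ ∈ W) : W = ⊤ := by
  have mkQ_eq_zero : W.mkQ = 0 := by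
    refine DirectSum.linearMap_ext K fun ⟨root, p, q⟩ => TensorProduct.ext' fun x y => ?_
    obtain ⟨σ, rfl, even⟩ : ∃ σ : Equiv.Perm (Fin 3), σ 2 = root ∧ Equiv.Perm.sign σ = 1 := by
      clear x y
      revert root
      decide
    have mem := h p q x y σ
    rw [leftTree, if_pos even] at mem
    exact (Submodule.Quotient.mk_eq_zero W).2 mem
  rw [← W.ker_mkQ, mkQ_eq_zero, LinearMap.ker_zero]

variable {ι : Type*} {deg : ι → ℤ} {g : ∀ i, E.obj (deg i)} {W : Submodule K (Quad E)}

theorem BinModule.IsGeneratedBy.leftTree_mem (hg : E.IsGeneratedBy g) {p : ℤ} {x : E.obj p}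
    (h : ∀ i σ, leftTree E x (g i) σ ∈ W) (q : ℤ) (y : E.obj q) (σ : Equiv.Perm (Fin 3)) :
    leftTree E x y σ ∈ W := by
  let U (q : ℤ) : Submodule K (E.obj q) := ⨅ σ, W.comap (leftTreeHom E p q σ x)
  have mem_U {q : ℤ} {y : E.obj q} : y ∈ U q ↔ ∀ σ, leftTree E x y σ ∈ W := by
    simp only [U, Submodule.mem_iInf, Submodule.mem_comap, leftTreeHom_apply]
  have stable (q : ℤ) (τ : Equiv.Perm (Fin 2)) : U q ≤ (U q).comap (E.rep q τ) := by
    intro y hy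
    rcases perm_fin_two_eq τ with rfl | rfl
    · rwa [map_one]
    · exact mem_U.2 fun σ => leftTree_swap_upper E x y σ ▸ mem_U.1 hy _
  exact mem_U.1 (Submodule.eq_top_iff'.1 (hg U stable (fun i => mem_U.2 (h i)) q) y) σ

theorem BinModule.IsGeneratedBy.eq_top_of_trees_mem (hg : E.IsGeneratedBy g)
    (hleft : ∀ i j σ, leftTree E (g i) (g j) σ ∈ W)
    (hright : ∀ i j σ, rightTree E (g i) (g j) σ ∈ W) : W = ⊤ := by
  let A (p : ℤ) : Submodule K (E.obj p) :=
    ⨅ (q : ℤ) (y : E.obj q) (σ : Equiv.Perm (Fin 3)), W.comap ((leftTreeHom E p q σ).flip y)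
  have mem_A {p : ℤ} {x : E.obj p} : x ∈ A p ↔ ∀ q (y : E.obj q) σ, leftTree E x y σ ∈ W := by
    simp only [A, Submodule.mem_iInf, Submodule.mem_comap, LinearMap.flip_apply,
      leftTreeHom_apply]
  let U (p : ℤ) : Submodule K (E.obj p) := A p ⊓ (A p).comap (E.rep p (Equiv.swap 0 1))
  have stable (p : ℤ) (τ : Equiv.Perm (Fin 2)) : U p ≤ (U p).comap (E.rep p τ) := by
    intro x hx
    rcases perm_fin_two_eq τ with rfl | rfl
    · rwa [map_one]
    · exact ⟨hx.2, Submodule.mem_comap.2 ((E.rep_swap_swap x).symm ▸ hx.1)⟩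
  have generator_mem (i : ι) : g i ∈ U (deg i) :=
    ⟨mem_A.2 (hg.leftTree_mem (hleft i)), mem_A.2 (hg.leftTree_mem fun j σ =>
      leftTree_swap_root E (g i) (g j) σ ▸ hright i j _)⟩
  exact eq_top_of_forall_leftTree_mem fun p q x y σ =>
    mem_A.1 (Submodule.eq_top_iff'.1 (hg U stable generator_mem p) x).1 q y σ

theorem eq_smul_regOne_add_smul (f : Equiv.Perm (Fin 2) → K) :
    f = f 1 • regOne K +
      -f (Equiv.swap 0 1) • sgnTwist (regular K) (Equiv.swap 0 1) (regOne K) := by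
  funext τ
  rcases perm_fin_two_eq τ with rfl | rfl <;>
    simp [sgnTwist, regular, regOne, LinearMap.funLeft_apply]

theorem BinModule.inDegree_eq_zero {V : Type u} [AddCommGroup V] [Module K V]
    {ρ : Representation K (Equiv.Perm (Fin 2)) V} {d₀ d : ℤ} (h : d ≠ d₀)
    (x : (BinModule.inDegree ρ d₀).obj d) : x = 0 :=
  funext fun hd => (h hd.down).elim

theorem isGeneratedBy_generatorN : (genN K).IsGeneratedBy (generatorN K) := by
  intro W stable mem d
  have nY_mem : nY K ∈ W (-1) := mem none
  have nW_mem : nW K ∈ W 0 := mem (some false)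
  have nB_mem : nB K ∈ W 0 := mem (some true)
  refine Submodule.eq_top_iff'.2 fun (a, b, c) => ?_
  by_cases hodd : d = -1
  · subst hodd
    rw [BinModule.inDegree_eq_zero (by decide) b, BinModule.inDegree_eq_zero (by decide) c]
    have : ((a, 0, 0) : (genN K).obj (-1)) = a ⟨rfl⟩ • nY K :=
      Prod.ext (funext fun _ => (mul_one (a ⟨rfl⟩)).symm)
        (Prod.ext (smul_zero (a ⟨rfl⟩)).symm (smul_zero (a ⟨rfl⟩)).symm)
    exact this ▸ (W (-1)).smul_mem _ nY_mem
  rw [BinModule.inDegree_eq_zero hodd a]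
  by_cases heven : d = 0
  · subst heven
    have span_mem {x : (genN K).obj 0} (hx : x ∈ W 0) (r s : K) :
        r • x + s • (genN K).rep 0 (Equiv.swap 0 1) x ∈ W 0 :=
      (W 0).add_mem ((W 0).smul_mem r hx) ((W 0).smul_mem s (stable 0 _ hx))
    have decomposition : ((0, b, c) : (genN K).obj 0) =
        (b ⟨rfl⟩ 1 • nW K + -b ⟨rfl⟩ (Equiv.swap 0 1) • (genN K).rep 0 (Equiv.swap 0 1) (nW K)) +
        (c ⟨rfl⟩ 1 • nB K +
          -c ⟨rfl⟩ (Equiv.swap 0 1) • (genN K).rep 0 (Equiv.swap 0 1) (nB K)) := by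
      have other (r s : K) :
          r • (0 : Equiv.Perm (Fin 2) → K) + s • sgnTwist (regular K) (Equiv.swap 0 1) 0 = 0 := by
        rw [map_zero, smul_zero, smul_zero, add_zero]
      refine Prod.ext (BinModule.inDegree_eq_zero (by decide) _).symm (Prod.ext ?_ ?_)
      · exact funext fun _ => (eq_smul_regOne_add_smul _).trans (add_eq_left.2 (other _ _)).symm
      · exact funext fun _ => (eq_smul_regOne_add_smul _).trans (add_eq_right.2 (other _ _)).symm
    exact decomposition ▸ (W 0).add_mem (span_mem nW_mem _ _) (span_mem nB_mem _ _)
  · rw [BinModule.inDegree_eq_zero heven b, BinModule.inDegree_eq_zero heven c]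
    exact (W d).zero_mem

theorem isGeneratedBy_generatorDual : (genM K).czechDual.IsGeneratedBy (generatorDual K) := by
  simpa only [dualIso_generatorN] using isGeneratedBy_generatorN.map (dualIso K)

end Generation

section Spanning

variable {K : Type u} [Field K] {E : BinModule K} {deg : Option Bool → ℤ}

/-- The relators with an even labelling of the leaves. As the permutations `σ` and `σ * (1 2)`
give the same pre-Lie relator up to sign, and `σ` and `σ * (0 1)` the same compatibility
relator, they represent all relators. -/
def RelIndex.IsEven : RelIndex → Prop
  | .preLie _ σ => Equiv.Perm.sign σ = 1
  | .mixed σ => Equiv.Perm.sign σ = 1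
  | .jacobi => True
  | .nijenhuis _ σ => Equiv.Perm.sign σ = 1

/-- The shape of the leading tree of a relator of `R`, decorated by arbitrary operations
`g none`, `g (some false)` and `g (some true)` as in `dualRel`. -/
noncomputable def leadingTree (g : ∀ i, E.obj (deg i)) : RelIndex → Quad E
  | .preLie x σ => leftTree E (g (some x)) (g (some x)) σ
  | .mixed σ => leftTree E (g (some true)) (g (some false)) σ
  | .jacobi => leftTree E (g none) (g none) 1
  | .nijenhuis x σ => leftTree E (g (some x)) (g none) σ

theorem sign_mul_swap_of_sign_eq_neg_one {α : Type*} [DecidableEq α] [Fintype α]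
    {σ : Equiv.Perm α} (odd : Equiv.Perm.sign σ = -1) {i j : α} (hij : i ≠ j) :
    Equiv.Perm.sign (σ * Equiv.swap i j) = 1 := by
  rw [Equiv.Perm.sign_mul, odd, Equiv.Perm.sign_swap hij, neg_mul_neg, one_mul]

variable {g : ∀ i, E.obj (deg i)} {W : Submodule K (Quad E)}
  (hrel : ∀ s, dualRel g s ∈ W) (hlead : ∀ r : RelIndex, r.IsEven → leadingTree g r ∈ W)
  (hskew : E.rep (deg none) (Equiv.swap 0 1) (g none) = -g none)

include hlead

section

include hskew

theorem leftTree_some_none_mem (x : Bool) (σ : Equiv.Perm (Fin 3)) :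
    leftTree E (g (some x)) (g none) σ ∈ W := by
  rcases Int.units_eq_one_or (Equiv.Perm.sign σ) with even | odd
  · exact hlead (.nijenhuis x σ) even
  · have mem := hlead (.nijenhuis x (σ * Equiv.swap 0 1))
      (sign_mul_swap_of_sign_eq_neg_one odd (by decide))
    rwa [leadingTree, ← leftTree_swap_upper, hskew, leftTree_neg_right, W.neg_mem_iff] at mem

end

include hrel

theorem leftTree_some_some_mem (x y : Bool) (σ : Equiv.Perm (Fin 3)) :
    leftTree E (g (some x)) (g (some y)) σ ∈ W := by
  have mem_of_even (τ : Equiv.Perm (Fin 3)) (even : Equiv.Perm.sign τ = 1) :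
      leftTree E (g (some x)) (g (some y)) τ ∈ W := by
    rcases x with _ | _ <;> rcases y with _ | _
    · exact hlead (.preLie false τ) even
    · exact (W.sub_mem_iff_right (hlead (.mixed τ) even)).1 (hrel (.left τ))
    · exact hlead (.mixed τ) even
    · exact hlead (.preLie true τ) even
  rcases Int.units_eq_one_or (Equiv.Perm.sign σ) with even | odd
  · exact mem_of_even σ even
  · exact (W.sub_mem_iff_left (mem_of_even _
      (sign_mul_swap_of_sign_eq_neg_one odd (by decide)))).1 (hrel (.perm x y σ))

theorem rightTree_some_some_mem (x y : Bool) (σ : Equiv.Perm (Fin 3)) :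
    rightTree E (g (some x)) (g (some y)) σ ∈ W :=
  (W.sub_mem_iff_right (leftTree_some_some_mem hrel hlead x y σ)).1 (hrel (.assoc x y σ))

include hskew

theorem rightTree_some_none_mem (x : Bool) (σ : Equiv.Perm (Fin 3)) :
    rightTree E (g (some x)) (g none) σ ∈ W := by
  have left_mem := leftTree_some_none_mem hlead hskew x
  exact (W.sub_mem_iff_left (left_mem _)).1
    ((W.add_mem_iff_left (left_mem σ)).1 (hrel (.leibniz x σ)))

theorem leftTree_none_some_mem (x : Bool) (σ : Equiv.Perm (Fin 3)) :
    leftTree E (g none) (g (some x)) σ ∈ W :=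
  (W.sub_mem_iff_left (leftTree_some_none_mem hlead hskew x _)).1 (hrel (.bracket x σ))

theorem leftTree_none_none_mem (σ : Equiv.Perm (Fin 3)) :
    leftTree E (g none) (g none) σ ∈ W := by
  have rotate {τ : Equiv.Perm (Fin 3)} (h : leftTree E (g none) (g none) τ ∈ W) :
      leftTree E (g none) (g none) (τ * finRotate 3) ∈ W := by
    have mem := (W.add_mem_iff_right h).1 (hrel (.odd τ))
    rwa [rightTree, hskew, leftTree_neg_left, W.neg_mem_iff] at mem
  have mem_of_even (τ : Equiv.Perm (Fin 3)) (even : Equiv.Perm.sign τ = 1) :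
      leftTree E (g none) (g none) τ ∈ W := by
    have mem_one : leftTree E (g none) (g none) 1 ∈ W := hlead .jacobi trivial
    obtain rfl | rfl | rfl :
        τ = 1 ∨ τ = 1 * finRotate 3 ∨ τ = 1 * finRotate 3 * finRotate 3 := by
      revert τ; decide
    exacts [mem_one, rotate mem_one, rotate (rotate mem_one)]
  rcases Int.units_eq_one_or (Equiv.Perm.sign σ) with even | odd
  · exact mem_of_even σ even
  · have mem := mem_of_even (σ * Equiv.swap 0 1)
      (sign_mul_swap_of_sign_eq_neg_one odd (by decide))
    rwa [← leftTree_swap_upper, hskew, leftTree_neg_right, W.neg_mem_iff] at mem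

theorem leftTree_generators_mem (i j : Option Bool) (σ : Equiv.Perm (Fin 3)) :
    leftTree E (g i) (g j) σ ∈ W := by
  rcases i with _ | x <;> rcases j with _ | y
  · exact leftTree_none_none_mem hrel hlead hskew σ
  · exact leftTree_none_some_mem hrel hlead hskew y σ
  · exact leftTree_some_none_mem hlead hskew x σ
  · exact leftTree_some_some_mem hrel hlead x y σ

theorem rightTree_generators_mem (i j : Option Bool) (σ : Equiv.Perm (Fin 3)) :
    rightTree E (g i) (g j) σ ∈ W := by
  rcases i with _ | x
  · rw [rightTree, hskew, leftTree_neg_left, W.neg_mem_iff]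
    exact leftTree_generators_mem hrel hlead hskew none j _
  · rcases j with _ | y
    · exact rightTree_some_none_mem hrel hlead hskew x σ
    · exact rightTree_some_some_mem hrel hlead x y σ

theorem eq_top_of_dualRel_mem_of_leadingTree_mem (hg : E.IsGeneratedBy g) : W = ⊤ :=
  hg.eq_top_of_trees_mem (leftTree_generators_mem hrel hlead hskew)
    (rightTree_generators_mem hrel hlead hskew)

end Spanning

section OrthogonalComplement

theorem mem_of_dual_family {R M N ι : Type*} [CommRing R] [AddCommGroup M] [Module R M]
    [AddCommGroup N] [Module R N] [DecidableEq ι] {B : M →ₗ[R] N →ₗ[R] R} {S : Submodule R M}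
    {v : ι → M} {r : ι → N} (orthogonal : ∀ s ∈ S, ∀ j, B s (r j) = 0)
    (dual : ∀ i j, B (v i) (r j) = if i = j then 1 else 0)
    (sup_eq_top : S ⊔ Submodule.span R (Set.range v) = ⊤) {f : M} (hf : ∀ j, B f (r j) = 0) :
    f ∈ S := by
  obtain ⟨s, hs, t, ht, rfl⟩ := Submodule.mem_sup.1 (Submodule.eq_top_iff'.1 sup_eq_top f)
  obtain ⟨c, rfl⟩ := Finsupp.mem_span_range_iff_exists_finsupp.1 ht
  have coefficient (j : ι) : B.flip (r j) (c.sum fun i a => a • v i) = c j := by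
    rw [map_finsuppSum, Finsupp.sum_eq_single j]
    · rw [map_smul, LinearMap.flip_apply, dual, if_pos rfl, smul_eq_mul, mul_one]
    · intro i _ hij
      rw [map_smul, LinearMap.flip_apply, dual, if_neg hij, smul_zero]
    · intro _
      rw [zero_smul, map_zero]
  have c_eq_zero : c = 0 := Finsupp.ext fun j => by
    rw [← coefficient j, LinearMap.flip_apply, Finsupp.zero_apply, ← hf j, map_add,
      LinearMap.add_apply, orthogonal s hs j, zero_add]
  rwa [c_eq_zero, Finsupp.sum_zero_index, add_zero]

variable {K : Type u} [Field K]

theorem preLieDelta_of_even {σ τ : Equiv.Perm (Fin 3)} (hσ : Equiv.Perm.sign σ = 1)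
    (hτ : Equiv.Perm.sign τ = 1) : preLieDelta σ τ = if σ = τ then 1 else 0 := by
  revert σ τ; decide

theorem nijDelta_of_even {σ τ : Equiv.Perm (Fin 3)} (hσ : Equiv.Perm.sign σ = 1)
    (hτ : Equiv.Perm.sign τ = 1) : nijDelta σ τ = if σ = τ then 1 else 0 := by
  revert σ τ; decide

theorem quadPairing_leadingTree_rel {r s : RelIndex} (hr : r.IsEven) (hs : s.IsEven) :
    quadPairing (genM K) (leadingTree (generatorDual K) r) (rel K s) = if r = s then 1 else 0 := by
  cases s with
  | jacobi => cases r <;> simp [leadingTree, quadPairing_leftTree_jacobi]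
  | preLie x τ =>
    cases r <;> simp_all [leadingTree, rel, quadPairing_leftTree_preLieRel, RelIndex.IsEven,
      preLieDelta_of_even, ite_and]
  | mixed τ =>
    cases r <;> simp_all [leadingTree, rel, quadPairing_leftTree_preLieRel, RelIndex.IsEven,
      preLieDelta_of_even]
  | nijenhuis x τ =>
    cases r <;> simp_all [leadingTree, rel, quadPairing_leftTree_nijRel, RelIndex.IsEven,
      nijDelta_of_even, ite_and]

theorem mem_orth_biNij_iff {f : Quad (genM K).czechDual} :
    f ∈ (biNij K).orth ↔ ∀ r, quadPairing (genM K) f (rel K r) = 0 := by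
  have mem_iff_le_ker : f ∈ (biNij K).orth ↔
      Submodule.span K (relR K) ≤ LinearMap.ker (quadPairing (genM K) f) := Iff.rfl
  simp only [mem_iff_le_ker, Submodule.span_le, relR_eq_range, Set.range_subset_iff,
    SetLike.mem_coe, LinearMap.mem_ker]

theorem span_dualRel_generatorDual :
    Submodule.span K (Set.range (dualRel (generatorDual K))) = (biNij K).orth := by
  have le_orth : Submodule.span K (Set.range (dualRel (generatorDual K))) ≤ (biNij K).orth :=
    Submodule.span_le.2 (Set.range_subset_iff.2 fun s =>
      mem_orth_biNij_iff.2 (quadPairing_dualRel_rel s))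
  have sup_eq_top : Submodule.span K (Set.range (dualRel (generatorDual K))) ⊔
      Submodule.span K (Set.range fun r : {r : RelIndex // r.IsEven} =>
        leadingTree (generatorDual K) r) = ⊤ :=
    eq_top_of_dualRel_mem_of_leadingTree_mem
      (fun s => Submodule.mem_sup_left (Submodule.subset_span ⟨s, rfl⟩))
      (fun r even => Submodule.mem_sup_right (Submodule.subset_span ⟨⟨r, even⟩, rfl⟩))
      rep_dualY_swap isGeneratedBy_generatorDual
  have dual (r s : {r : RelIndex // r.IsEven}) :
      quadPairing (genM K) (leadingTree (generatorDual K) r) (rel K s) =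
        if r = s then 1 else 0 := by
    simp only [quadPairing_leadingTree_rel r.2 s.2, Subtype.ext_iff]
  exact le_antisymm le_orth fun f hf =>
    mem_of_dual_family (v := fun r : {r : RelIndex // r.IsEven} =>
        leadingTree (generatorDual K) r) (r := fun r : {r : RelIndex // r.IsEven} => rel K r)
      (fun s hs r => mem_orth_biNij_iff.1 (le_orth hs) r) dual sup_eq_top
      fun r => mem_orth_biNij_iff.1 hf r

end OrthogonalComplement

end BiNijenhuis

theorem mainTheorem9_general (K : Type u) [Field K] :
    ∃ φ : (genN K).Iso (genM K).czechDual,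
      φ.toEquiv (-1) (nY K) = dualY K ∧
      φ.toEquiv 0 (nW K) = dualW K ∧
      φ.toEquiv 0 (nB K) = dualB K ∧
      (Submodule.span K (relS K)).map (quadMap φ) = (biNij K).orth ∧
      ∃ Φ : (biNijDual K).operad.Iso (biNij K).koszulDual.operad,
        ∀ (d : ℤ) (x : (genN K).obj d),
          Φ.toEquiv 2 d ((biNijDual K).gen x) =
            (biNij K).koszulDual.gen (φ.toEquiv d x) := by
  have map_eq_orth : (Submodule.span K (relS K)).map (quadMap (dualIso K)) = (biNij K).orth :=
    map_span_relS.trans span_dualRel_generatorDual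
  exact ⟨dualIso K, dualIso_nY, dualIso_nW, dualIso_nB, map_eq_orth,
    (biNijDual K).operadIso (biNij K).koszulDual (dualIso K) map_eq_orth,
    QuadraticData.operadIso_gen (biNijDual K) (biNij K).koszulDual (dualIso K) map_eq_orth⟩

theorem mainTheorem9 (K : Type u) [Field K] [CharZero K] :
    ∃ φ : (genN K).Iso (genM K).czechDual,
      φ.toEquiv (-1) (nY K) = dualY K ∧
      φ.toEquiv 0 (nW K) = dualW K ∧
      φ.toEquiv 0 (nB K) = dualB K ∧
      (Submodule.span K (relS K)).map (quadMap φ) = (biNij K).orth ∧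
      ∃ Φ : (biNijDual K).operad.Iso (biNij K).koszulDual.operad,
        ∀ (d : ℤ) (x : (genN K).obj d),
          Φ.toEquiv 2 d ((biNijDual K).gen x) =
            (biNij K).koszulDual.gen (φ.toEquiv d x) :=
  mainTheorem9_general K
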